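/- **Setup.** Let $p\ge 1$, $q\ge 0$. A random vector $Z\in\mathbb R^q$ and a random matrix $\hat A\in\mathbb R^{q\times p}$, both square integrable, are observed. Fix $\mu>0$, a penalty matrix $G$ on $\mathbb R^p$ and a linear map $\mathcal K$ on $\mathbb R^{q\times p}$; write $G^2=G^\top G$, $\mathcal K^2=\mathcal K^\top\mathcal K$, $\|A\|_{\mathcal K}=\|\mathcal K A\|_{\rm Fr}$. For $\upsilon=(\theta,\eta,A)\in\mathbb R^p\times\mathbb R^q\times\mathbb R^{q\times p}$ let $$\mathcal L(\upsilon)=-\tfrac12\|Z-\eta\|^2-\tfrac{\mu^2}{2}\|A-\hat A\|_{\rm Fr}^2-\tfrac12\|\eta-A\theta\|^2,\qquad \mathcal L_{\mathcal G}(\upsilon)=\mathcal L(\upsilon)-\tfrac12\|G\theta\|^2-\tfrac12\|A\|_{\mathcal K}^2 .$$ Let $\upsilon^*=(\theta^*,\eta^*,A^*)$ be a maximizer of $\mathbb E\mathcal L$, $\upsilon^*_{\mathcal G}=(\theta^*_{\mathcal G},\eta^*_{\mathcal G},A^*_{\mathcal G})$ a maximizer of $\mathbb E\mathcal L_{\mathcal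 G}$ and $\tilde\upsilon_{\mathcal G}=(\tilde\theta_{\mathcal G},\tilde\eta_{\mathcal G},\tilde A_{\mathcal G})$ a measurable maximizer of $\mathcal L_{\mathcal G}$ (each over the whole parameter space; the last one is needed only on the event $\Omega(x)$ below). Write $\nu=(\eta,A)$ for the nuisance, $\mathcal G^2=\mathrm{block}\{G^2,0,\mathcal K^2\}$, $\mathbb F=-\nabla^2\mathbb E\mathcal L(\upsilon^*_{\mathcal G})$, $\mathbb F_{\mathcal G}=\mathbb F+\mathcal G^2$, $\Phi=\mathbb F_{\mathcal G,\theta\theta}-\mathbb F_{\theta\nu}\mathbb F_{\mathcal G,\nu\nu}^{-1}\mathbb F_{\nu\theta}$. The score is $\nabla\zeta=(0,\omega,\mu U)$ with $\omega=Z-\mathbb EZ$, $U=\mu(\hat A-\mathbb E\hat A)$. Let $D$ be a symmetric positive definite $p\times p$ matrix with $$A^{*\top}A^*\le D^2\le A^{*\top}A^*+G^2 .$$ Put $N=\lambda_{\min}(D^2)$, $\kappa=2$, $\tau_3=4.5\,N^{-1/2}\mu^{-1}$, $\mathcal D=\mathrm{block}\{D,I,\mu I\}$, $\mathcal D_{\nu\nu}=\mathrm{block}\{I,\mu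 I\}$. For $\delta_0\le 1/10$ let $R=\delta_0\mu\sqrt N$ and $$\Upsilon^\circ=\{(\theta,\eta,A):\ \|D\theta\|\le R,\ \|\eta\|\le R,\ \|(A-A^*)D^{-1}\|_{\rm Fr}\le\delta_0\}.$$ For $x>0$ and a positive semidefinite matrix $B$ let $z(B,x)=\bigl(\operatorname{tr}B+2\sqrt{x\operatorname{tr}B^2}+2x\|B\|\bigr)^{1/2}$. Put $B_{\mathcal D}=\operatorname{Var}(\mathcal D\mathbb F_{\mathcal G}^{-1}\nabla\zeta)$, $r_{\mathcal D}=z(B_{\mathcal D},x)$, $b_{\mathcal D}=\|\mathcal D\mathbb F_{\mathcal G}^{-1}\mathcal G^2\upsilon^*\|$, $\bar p_{\mathcal D}=\operatorname{tr}B_{\mathcal D}$ and $\Omega(x)=\{\|\mathcal D\mathbb F_{\mathcal G}^{-1}\nabla\zeta\|\le r_{\mathcal D}\}$. **Theorem.** Assume the deviation condition $\mathbb P(\|\mathcal D\mathbb F_{\mathcal G}^{-1}\nabla\zeta\|>z(B_{\mathcal D},x))\le 3e^{-x}$, the localization $\upsilon^*\in\Upsilon^\circ$, $\upsilon^*_{\mathcal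 G}\in\Upsilon^\circ$ and $\tilde\upsilon_{\mathcal G}\in\Upsilon^\circ$ on $\Omega(x)$, and $$R\ge\tfrac32(r_{\mathcal D}\vee b_{\mathcal D}),\qquad \kappa^2\tau_3\,(r_{\mathcal D}\vee b_{\mathcal D})<\tfrac49 .$$ Then $\mathbb F_{\mathcal G}$ and $\Phi$ are positive definite, $\mathbb P(\Omega(x))\ge 1-3e^{-x}$, $\bar p_{\mathcal D}=\mathbb E\|\mathcal D\mathbb F_{\mathcal G}^{-1}\nabla\zeta\|^2$, and for every linear map $Q:\mathbb R^p\to\mathbb R^m$, $m\ge 0$, with $c_Q=\|QD^{-1}\|\,\frac{3\kappa^2\tau_3}{4}$: 1. (Fisher expansion) on $\Omega(x)$, $\ \|Q\{\tilde\theta_{\mathcal G}-\theta^*_{\mathcal G}-(\mathbb F_{\mathcal G}^{-1}\nabla\zeta)_\theta\}\|\le c_Q\,\|\mathcal D\mathbb F_{\mathcal G}^{-1}\nabla\zeta\|^2$. Here $\|\mathcal D\mathbb F_{\mathcal G}^{-1}\nabla\zeta\|\le r_{\mathcal D}\le\sqrt{\operatorname{tr}B_{\mathcal D}}+\sqrt{2x\|B_{\mathcal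 D}\|}$ on $\Omega(x)$ and, everywhere, $\|\mathcal D\mathbb F_{\mathcal G}^{-1}\nabla\zeta\|^2\le\kappa^4\|\omega\|^2+\kappa^4\|(I+\kappa^2\mu^{-2}\mathcal K^2)^{-1/2}U\|_{\rm Fr}^2$. 2. (Wilks expansion) with $\mathbb L_{\mathcal G}(\theta)=\sup_{\nu}\mathcal L_{\mathcal G}(\theta,\nu)$ and $\breve\xi=\Phi^{1/2}(\mathbb F_{\mathcal G}^{-1}\nabla\zeta)_\theta$, on $\Omega(x)$, $$\bigl|2\mathbb L_{\mathcal G}(\tilde\theta_{\mathcal G})-2\mathbb L_{\mathcal G}(\theta^*_{\mathcal G})-\|\breve\xi\|^2\bigr|\le\tfrac{\tau_3}{2}\bigl(\|\mathcal D\mathbb F_{\mathcal G}^{-1}\nabla\zeta\|^3+\|\mathcal D_{\nu\nu}\mathbb F_{\mathcal G,\nu\nu}^{-1}\nabla_\nu\zeta\|^3\bigr).$$ 3. (Bias) $\|Q\{\theta^*_{\mathcal G}-\theta^*+(\mathbb F_{\mathcal G}^{-1}\mathcal G^2\upsilon^*)_\theta\}\|\le c_Q\,b_{\mathcal D}^2$.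 4. (PAC loss bound) on $\Omega(x)$, $\ \|Q\{\tilde\theta_{\mathcal G}-\theta^*-(\mathbb F_{\mathcal G}^{-1}\nabla\zeta)_\theta+(\mathbb F_{\mathcal G}^{-1}\mathcal G^2\upsilon^*)_\theta\}\|\le c_Q\bigl(\|\mathcal D\mathbb F_{\mathcal G}^{-1}\nabla\zeta\|^2+b_{\mathcal D}^2\bigr)$. 5. ($L_2$-norm risk bound) $\|Q(\tilde\theta_{\mathcal G}-\theta^*)\|^2 1_{\Omega(x)}$ is integrable and $\mathbb E\{\|Q(\tilde\theta_{\mathcal G}-\theta^*)\|1_{\Omega(x)}\}\le\mathcal R_Q^{1/2}+c_Q(\bar p_{\mathcal D}+b_{\mathcal D}^2)$, where $$\mathcal R_Q=\mathbb E\bigl\{\|Q(\mathbb F_{\mathcal G}^{-1}\nabla\zeta)_\theta-Q(\mathbb F_{\mathcal G}^{-1}\mathcal G^2\upsilon^*)_\theta\|^2 1_{\Omega(x)}\bigr\}\le\operatorname{tr}\operatorname{Var}\{Q(\mathbb F_{\mathcal G}^{-1}\nabla\zeta)_\theta\}+\|Q(\mathbb F_{\mathcal G}^{-1}\mathcal G^2\upsilon^*)_\theta\|^2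 .$$ 6. (Squared risk bound) if $\mathcal R_Q>0$, $C_4\ge 0$, $\mathbb E\{\|\mathcal D\mathbb F_{\mathcal G}^{-1}\nabla\zeta\|^4 1_{\Omega(x)}\}\le C_4^2\,\bar p_{\mathcal D}^2$ and $\alpha_Q=c_Q(C_4\bar p_{\mathcal D}+b_{\mathcal D}^2)/\sqrt{\mathcal R_Q}<1$, then $$(1-\alpha_Q)^2\mathcal R_Q\le\mathbb E\{\|Q(\tilde\theta_{\mathcal G}-\theta^*)\|^2 1_{\Omega(x)}\}\le(1+\alpha_Q)^2\mathcal R_Q .$$ -/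

import Mathlib

open MeasureTheory ProbabilityTheory

noncomputable section

namespace ErrInOp

/-- Indices of the nuisance `ν = (η, A)`: an image `η ∈ ℝ^q` and an operator `A ∈ ℝ^{q × p}`. -/
abbrev NIdx (p q : ℕ) : Type := Fin q ⊕ (Fin q × Fin p)

/-- Indices of the full parameter `υ = (θ, η, A)`, of dimension `p + q + p q`. -/
abbrev Idx (p q : ℕ) : Type := Fin p ⊕ NIdx p q

/-- Operators `ℝ^p → ℝ^q` as vectors of entries; the norm is the Frobenius norm. -/
abbrev Op (p q : ℕ) : Type := EuclideanSpace ℝ (Fin q × Fin p)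

abbrev Nuis (p q : ℕ) : Type := EuclideanSpace ℝ (NIdx p q)

abbrev Param (p q : ℕ) : Type := EuclideanSpace ℝ (Idx p q)

/-- The matrix with the given entries. -/
def toMat {p q : ℕ} (A : Op p q) : Matrix (Fin q) (Fin p) ℝ := Matrix.of fun m j => A (m, j)

/-- The target component `θ` of `υ = (θ, η, A)`. -/
def target {p q : ℕ} (υ : Param p q) : EuclideanSpace ℝ (Fin p) :=
  WithLp.toLp 2 fun j => υ (Sum.inl j)

/-- The nuisance component `ν = (η, A)` of `υ = (θ, η, A)`. -/
def nuis {p q : ℕ} (υ : Param p q) : Nuis p q := WithLp.toLp 2 fun i => υ (Sum.inr i)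

/-- The image component `η` of `υ = (θ, η, A)`. -/
def image {p q : ℕ} (υ : Param p q) : EuclideanSpace ℝ (Fin q) :=
  WithLp.toLp 2 fun m => υ (Sum.inr (Sum.inl m))

/-- The operator component `A` of `υ = (θ, η, A)`. -/
def oper {p q : ℕ} (υ : Param p q) : Op p q :=
  WithLp.toLp 2 fun i => υ (Sum.inr (Sum.inr i))

/-- The nuisance `ν = (η, A)` with the given components. -/
def mkNuis {p q : ℕ} (η : EuclideanSpace ℝ (Fin q)) (A : Op p q) : Nuis p q :=
  WithLp.toLp 2 (Sum.elim (fun m => η m) (fun i => A i))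

/-- The full parameter `υ = (θ, ν)` with the given components. -/
def mkParam {p q : ℕ} (θ : EuclideanSpace ℝ (Fin p)) (ν : Nuis p q) : Param p q :=
  WithLp.toLp 2 (Sum.elim (fun j => θ j) (fun i => ν i))

/-- The action of a matrix on Euclidean vectors. -/
def act {m n : Type*} [Fintype m] [Fintype n] [DecidableEq n] (M : Matrix m n ℝ)
    (v : EuclideanSpace ℝ n) : EuclideanSpace ℝ m := Matrix.toEuclideanLin M v

/-- The operator norm of a matrix with respect to the Euclidean norms. -/
def opNorm {m n : Type*} [Fintype m] [Fintype n] [DecidableEq n] (M : Matrix m n ℝ) : ℝ :=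
  ‖LinearMap.toContinuousLinearMap (Matrix.toEuclideanLin M)‖

/-- The Frobenius norm of a matrix. -/
def frobNorm {m n : Type*} [Fintype m] [Fintype n] (M : Matrix m n ℝ) : ℝ :=
  √(∑ i, ∑ j, M i j ^ 2)

open scoped MatrixOrder in
/-- The positive semidefinite square root `M^{1/2}` of a positive semidefinite matrix. -/
def matSqrt {n : Type*} [Fintype n] [DecidableEq n] (M : Matrix n n ℝ) : Matrix n n ℝ :=
  CFC.sqrt M

/-- The smallest eigenvalue of a symmetric matrix. -/
def lamMin {n : Type*} [Fintype n] [DecidableEq n] (M : Matrix n n ℝ) : ℝ :=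
  sInf (spectrum ℝ M)

/-- The covariance matrix `Var(X)` of a random vector. -/
def covMat {Ω : Type*} [MeasurableSpace Ω] (P : Measure Ω) {n : Type*}
    (X : Ω → EuclideanSpace ℝ n) : Matrix n n ℝ :=
  Matrix.of fun i j => cov[fun ω => X ω i, fun ω => X ω j; P]

/-- The quantile-type function
`z(B, x) = (tr B + 2 √(x tr B²) + 2 x ‖B‖)^{1/2}`. -/
def zFun {n : Type*} [Fintype n] [DecidableEq n] (B : Matrix n n ℝ) (x : ℝ) : ℝ :=
  √(B.trace + 2 * √(x * (B * B).trace) + 2 * x * opNorm B)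

/-- The deviation condition at level `x` for the linear image `T ξ` of a random vector `ξ`:
`P(‖T ξ‖ > z(Var(T ξ), x)) ≤ 3 e^{-x}`. -/
def DeviationCondition {Ω : Type*} [MeasurableSpace Ω] (P : Measure Ω) {n : Type*} [Fintype n]
    [DecidableEq n] (T : Matrix n n ℝ) (ξ : Ω → EuclideanSpace ℝ n) (x : ℝ) : Prop :=
  P.real {ω | zFun (covMat P fun ω' => act T (ξ ω')) x < ‖act T (ξ ω)‖} ≤ 3 * Real.exp (-x)

/-- The data of an error-in-operator model: the law of the observations, the noisy image `Z`,
the pilot estimate `Â` of the operator, the weight `μ` and the two penalty matrices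
`G` (acting on `θ`) and `𝒦` (acting on the entries of `A`). -/
structure Model (p q : ℕ) (Ω : Type*) [MeasurableSpace Ω] where
  P : Measure Ω
  Z : Ω → EuclideanSpace ℝ (Fin q)
  Ahat : Ω → Op p q
  μ : ℝ
  G : Matrix (Fin p) (Fin p) ℝ
  K : Matrix (Fin q × Fin p) (Fin q × Fin p) ℝ

namespace Model

variable {p q : ℕ} {Ω : Type*} [MeasurableSpace Ω] (M : Model p q Ω)

/-- `ℒ(υ) = -‖Z - η‖²/2 - μ²‖A - Â‖²_Fr/2 - ‖η - A θ‖²/2`. -/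
def L (ω : Ω) (υ : Param p q) : ℝ :=
  -(1 / 2) * ‖M.Z ω - image υ‖ ^ 2 - M.μ ^ 2 / 2 * ‖oper υ - M.Ahat ω‖ ^ 2
    - 1 / 2 * ‖image υ - act (toMat (oper υ)) (target υ)‖ ^ 2

/-- The expectation `𝔼 ℒ(υ)`. -/
def EL (υ : Param p q) : ℝ := ∫ ω, M.L ω υ ∂M.P

/-- The quadratic penalty `‖G θ‖²/2 + ‖A‖²_𝒦/2` with `‖A‖_𝒦 = ‖𝒦 A‖`. -/
def pen (υ : Param p q) : ℝ :=
  1 / 2 * ‖act M.G (target υ)‖ ^ 2 + 1 / 2 * ‖act M.K (oper υ)‖ ^ 2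

/-- The penalized log-likelihood `ℒ_𝒢(υ)`. -/
def LG (ω : Ω) (υ : Param p q) : ℝ := M.L ω υ - M.pen υ

/-- The expectation `𝔼 ℒ_𝒢(υ)`. -/
def ELG (υ : Param p q) : ℝ := M.EL υ - M.pen υ

/-- The profile `𝕃_𝒢(θ) = sup_ν ℒ_𝒢(θ, ν)`, over all nuisance parameters `ν = (η, A)`. -/
def profile (ω : Ω) (θ : EuclideanSpace ℝ (Fin p)) : ℝ := ⨆ ν : Nuis p q, M.LG ω (mkParam θ ν)

/-- The observation error `ω = Z - 𝔼 Z`. -/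
def noiseZ (ω : Ω) : EuclideanSpace ℝ (Fin q) := M.Z ω - ∫ ω', M.Z ω' ∂M.P

/-- The scaled operator error `U = μ (Â - 𝔼 Â)`. -/
def noiseU (ω : Ω) : Op p q := M.μ • (M.Ahat ω - ∫ ω', M.Ahat ω' ∂M.P)

/-- The score `∇ζ = (0, ω, μ U)`, the gradient of `ζ = ℒ - 𝔼 ℒ`. -/
def score (ω : Ω) : Param p q := mkParam 0 (mkNuis (M.noiseZ ω) (M.μ • M.noiseU ω))

/-- The information matrix `𝔽(υ) = -∇² 𝔼 ℒ(υ)`. -/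
def info (υ : Param p q) : Matrix (Idx p q) (Idx p q) ℝ :=
  Matrix.of fun i j =>
    -(fderiv ℝ (fderiv ℝ M.EL) υ (EuclideanSpace.single i 1) (EuclideanSpace.single j 1))

/-- The penalty matrix `𝒢² = block{G², 0, 𝒦²}`. -/
def penMat : Matrix (Idx p q) (Idx p q) ℝ :=
  Matrix.fromBlocks (M.G.transpose * M.G) 0 0
    (Matrix.fromBlocks 0 0 0 (M.K.transpose * M.K))

/-- The penalized information matrix `𝔽_𝒢(υ) = 𝔽(υ) + 𝒢²`. -/
def infoG (υ : Param p q) : Matrix (Idx p q) (Idx p q) ℝ := M.info υ + M.penMat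

/-- The semiparametric information matrix, the Schur complement
`Φ = 𝔽_{𝒢,θθ} - 𝔽_{θν} 𝔽_{𝒢,νν}⁻¹ 𝔽_{νθ}`. -/
def semiInfo (υ : Param p q) : Matrix (Fin p) (Fin p) ℝ :=
  (M.infoG υ).toBlocks₁₁
    - (M.infoG υ).toBlocks₁₂ * ((M.infoG υ).toBlocks₂₂)⁻¹ * (M.infoG υ).toBlocks₂₁

/-- The nuisance block `𝒟_νν = block{I, μ I}` of the metric tensor. -/
def metricNuis : Matrix (NIdx p q) (NIdx p q) ℝ :=
  Matrix.fromBlocks 1 0 0 (M.μ • (1 : Matrix (Fin q × Fin p) (Fin q × Fin p) ℝ))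

/-- The metric tensor `𝒟 = block{D, I, μ I}`. -/
def metric (D : Matrix (Fin p) (Fin p) ℝ) : Matrix (Idx p q) (Idx p q) ℝ :=
  Matrix.fromBlocks D 0 0 M.metricNuis

/-- The radius `R = δ₀ μ √N`, where `N = λ_min(D²)`. -/
def radius (D : Matrix (Fin p) (Fin p) ℝ) (δ₀ : ℝ) : ℝ := δ₀ * M.μ * √(lamMin (D * D))

/-- The smoothness constant `τ₃ = 4.5 N^{-1/2} μ^{-1}`. -/
def tau3 (D : Matrix (Fin p) (Fin p) ℝ) : ℝ := 9 / 2 / (√(lamMin (D * D)) * M.μ)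

/-- The local set
`Υ° = {(θ, η, A) : ‖D θ‖ ≤ R, ‖η‖ ≤ R, ‖(A - A*) D⁻¹‖_Fr ≤ δ₀}`. -/
def localSet (D : Matrix (Fin p) (Fin p) ℝ) (δ₀ : ℝ) (Astar : Op p q) : Set (Param p q) :=
  {υ | ‖act D (target υ)‖ ≤ M.radius D δ₀ ∧ ‖image υ‖ ≤ M.radius D δ₀ ∧
    frobNorm (toMat (oper υ - Astar) * D⁻¹) ≤ δ₀}

/-- The stochastic term `𝔽_𝒢⁻¹ ∇ζ`, with `𝔽_𝒢` computed at `υG`. -/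
def stoch (υG : Param p q) (ω : Ω) : Param p q := act (M.infoG υG)⁻¹ (M.score ω)

/-- The bias term `𝔽_𝒢⁻¹ 𝒢² υ*`, with `𝔽_𝒢` computed at `υG`. -/
def bias (υG υs : Param p q) : Param p q := act ((M.infoG υG)⁻¹ * M.penMat) υs

/-- The standardized stochastic term `𝒟 𝔽_𝒢⁻¹ ∇ζ`. -/
def stdStoch (D : Matrix (Fin p) (Fin p) ℝ) (υG : Param p q) (ω : Ω) : Param p q :=
  act (M.metric D * (M.infoG υG)⁻¹) (M.score ω)

/-- The nuisance version `𝒟_νν 𝔽_{𝒢,νν}⁻¹ ∇_ν ζ`. -/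
def stdStochNuis (υG : Param p q) (ω : Ω) : Nuis p q :=
  act (M.metricNuis * ((M.infoG υG).toBlocks₂₂)⁻¹) (nuis (M.score ω))

/-- `B_𝒟 = Var(𝒟 𝔽_𝒢⁻¹ ∇ζ)`. -/
def BD (D : Matrix (Fin p) (Fin p) ℝ) (υG : Param p q) : Matrix (Idx p q) (Idx p q) ℝ :=
  covMat M.P (M.stdStoch D υG)

/-- `r_𝒟 = z(B_𝒟, x)`. -/
def rD (D : Matrix (Fin p) (Fin p) ℝ) (υG : Param p q) (x : ℝ) : ℝ := zFun (M.BD D υG) x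

/-- `b_𝒟 = ‖𝒟 𝔽_𝒢⁻¹ 𝒢² υ*‖`. -/
def bD (D : Matrix (Fin p) (Fin p) ℝ) (υG υs : Param p q) : ℝ := ‖act (M.metric D) (M.bias υG υs)‖

/-- The effective dimension `tr Var(𝒟 𝔽_𝒢⁻¹ ∇ζ) = tr B_𝒟`. -/
def effDim (D : Matrix (Fin p) (Fin p) ℝ) (υG : Param p q) : ℝ := (M.BD D υG).trace

/-- The random set `Ω(x) = {‖𝒟 𝔽_𝒢⁻¹ ∇ζ‖ ≤ r_𝒟}`. -/
def goodSet (D : Matrix (Fin p) (Fin p) ℝ) (υG : Param p q) (x : ℝ) : Set Ω :=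
  {ω | ‖M.stdStoch D υG ω‖ ≤ M.rD D υG x}

/-- The semiparametric score `ξ̆ = Φ^{1/2} (𝔽_𝒢⁻¹ ∇ζ)_θ`. -/
def semiScore (υG : Param p q) (ω : Ω) : EuclideanSpace ℝ (Fin p) :=
  act (matSqrt (M.semiInfo υG)) (target (M.stoch υG ω))

/-- `ℛ_Q = 𝔼 {‖Q (𝔽_𝒢⁻¹ ∇ζ)_θ - Q (𝔽_𝒢⁻¹ 𝒢² υ*)_θ‖² 1_{Ω(x)}}`. -/
def riskQ {m : ℕ} (D : Matrix (Fin p) (Fin p) ℝ) (υG υs : Param p q) (x : ℝ)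
    (Q : Matrix (Fin m) (Fin p) ℝ) : ℝ :=
  ∫ ω in M.goodSet D υG x,
    ‖act Q (target (M.stoch υG ω)) - act Q (target (M.bias υG υs))‖ ^ 2 ∂M.P

end Model

end ErrInOp

end

/-!
The expected log-likelihood is a polynomial of degree four in `υ = (θ, η, A)`, and the only term
that is not quadratic is `-‖η - A θ‖² / 2`. The stochastic part of the log-likelihood is linear in
`υ`, with gradient `∇ζ`. Therefore the maximizer `υ̃_𝒢`, and likewise the truth `υ*`, is a critical
point of the expected penalized log-likelihood perturbed by a linear term `⟨s, ·⟩`, with `s = ∇ζ`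
and `s = 𝒢² υ*` respectively. Everything reduces to the effect of such a perturbation on the
maximizer `υ*_𝒢`.

* The Taylor expansions of the objective and of its gradient at a point `υ` are exact when the third
  derivative is taken at the points `υ + δ / 4` and `υ + δ / 3` (`lossG_add`, `gradG_add`), so that
  no integral remainder is needed.
* On the local set, the information matrix dominates `𝒟² / 4` plus the penalty on `A`
  (`Near.quarter_le_hessG`). This gives positive definiteness and, by the Cauchy-Schwarz inequality,
  the bound `norm_stdStoch_sq_le` for the stochastic term.
* The third derivative is bounded in the metric `𝒟` by `3.32 / (μ √N)` instead of
  `τ₃ = 4.5 / (μ √N)` (`Near.scale_mul_abs_tri_le`). The gain is essential: for a general smooth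
  concave function with the constant `τ₃`, the error in the expansion of the maximizer can exceed
  `(3 κ² τ₃ / 4) ‖𝒟 𝔽_𝒢⁻¹ s‖²`.
* The perturbed objective has a critical point in a ball of radius `1.265 ‖𝒟 𝔽_𝒢⁻¹ s‖` around
  `υ*_𝒢` (`exists_critical`), and the gradient is strictly monotone between this ball and the local
  set, so the critical point is the given one (`Near.eq_of_gradG_eq`). Inserting the radius into the
  expansion of the gradient gives the expansion of the maximizer (`critical_expansion`), hence the
  Fisher expansion and the bias, whose sum is the loss bound.
* For the Wilks expansion, `maximum_expansion` treats the full maximum. At a fixed target the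
  objective is quadratic in the nuisance, so the profile at `θ*_𝒢` is explicit
  (`profile_target_eq`), and the two quadratic forms differ by that of the Schur complement
  (`inner_inv_eq_add_schur`).
* The risk bounds follow from the loss bound by the triangle inequality in `L¹` and `L²` of the
  restriction of `P` to `Ω(x)`.
-/

noncomputable section

/-! ### Linear algebra -/

namespace ErrInOp

open scoped RealInnerProductSpace

section LinearAlgebra

variable {l m n : Type*} [Fintype l] [Fintype m] [Fintype n]

lemma inner_eq_sum (u v : EuclideanSpace ℝ n) : ⟪u, v⟫ = ∑ i, u i * v i := by
  simp [PiLp.inner_apply, mul_comm]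

lemma norm_sq_eq_sum (v : EuclideanSpace ℝ n) : ‖v‖ ^ 2 = ∑ i, v i ^ 2 := by
  simp [EuclideanSpace.norm_sq_eq]

variable [DecidableEq n]

lemma act_apply (M : Matrix m n ℝ) (v : EuclideanSpace ℝ n) (i : m) :
    act M v i = ∑ j, M i j * v j := rfl

@[simp] lemma act_add (M : Matrix m n ℝ) (u v : EuclideanSpace ℝ n) :
    act M (u + v) = act M u + act M v := map_add _ _ _

@[simp] lemma act_sub (M : Matrix m n ℝ) (u v : EuclideanSpace ℝ n) :
    act M (u - v) = act M u - act M v := map_sub _ _ _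

@[simp] lemma act_neg (M : Matrix m n ℝ) (v : EuclideanSpace ℝ n) :
    act M (-v) = -act M v := map_neg _ _

@[simp] lemma act_smul (M : Matrix m n ℝ) (c : ℝ) (v : EuclideanSpace ℝ n) :
    act M (c • v) = c • act M v := map_smul _ _ _

@[simp] lemma act_zero (M : Matrix m n ℝ) : act M (0 : EuclideanSpace ℝ n) = 0 := map_zero _

lemma add_act (M N : Matrix m n ℝ) (v : EuclideanSpace ℝ n) :
    act (M + N) v = act M v + act N v := by
  simp [act]

lemma sub_act (M N : Matrix m n ℝ) (v : EuclideanSpace ℝ n) :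
    act (M - N) v = act M v - act N v := by
  simp [act]

lemma smul_act (c : ℝ) (M : Matrix m n ℝ) (v : EuclideanSpace ℝ n) :
    act (c • M) v = c • act M v := by
  simp [act]

@[simp] lemma one_act (v : EuclideanSpace ℝ n) : act (1 : Matrix n n ℝ) v = v := by
  simp [act]

lemma mul_act [DecidableEq m] (M : Matrix l m ℝ) (N : Matrix m n ℝ) (v : EuclideanSpace ℝ n) :
    act (M * N) v = act M (act N v) := by
  simp [act, Matrix.toLpLin_apply, Matrix.mulVec_mulVec]

lemma inner_act_left [DecidableEq m] (M : Matrix m n ℝ) (v : EuclideanSpace ℝ n)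
    (u : EuclideanSpace ℝ m) :
    ⟪act M v, u⟫ = ⟪v, act M.transpose u⟫ := by
  simp only [inner_eq_sum, act_apply, Finset.sum_mul, Finset.mul_sum, Matrix.transpose_apply]
  rw [Finset.sum_comm]
  exact Finset.sum_congr rfl fun i _ => Finset.sum_congr rfl fun j _ => by ring

lemma inner_transpose_mul_act [DecidableEq m] (M : Matrix m n ℝ) (u v : EuclideanSpace ℝ n) :
    ⟪act (M.transpose * M) u, v⟫ = ⟪act M u, act M v⟫ := by
  rw [mul_act, inner_act_left, Matrix.transpose_transpose]

lemma continuous_act (M : Matrix m n ℝ) : Continuous (act M) :=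
  (LinearMap.toContinuousLinearMap (Matrix.toEuclideanLin M)).continuous

lemma norm_act_le (M : Matrix m n ℝ) (v : EuclideanSpace ℝ n) :
    ‖act M v‖ ≤ opNorm M * ‖v‖ :=
  (LinearMap.toContinuousLinearMap (Matrix.toEuclideanLin M)).le_opNorm v

lemma opNorm_nonneg (M : Matrix m n ℝ) : 0 ≤ opNorm M := norm_nonneg _

lemma act_inv_act {M : Matrix n n ℝ} (hM : IsUnit M) (v : EuclideanSpace ℝ n) :
    act M (act M⁻¹ v) = v := by
  rw [← mul_act, Matrix.mul_nonsing_inv _ ((Matrix.isUnit_iff_isUnit_det _).1 hM), one_act]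

lemma inv_act_act {M : Matrix n n ℝ} (hM : IsUnit M) (v : EuclideanSpace ℝ n) :
    act M⁻¹ (act M v) = v := by
  rw [← mul_act, Matrix.nonsing_inv_mul _ ((Matrix.isUnit_iff_isUnit_det _).1 hM), one_act]

lemma posSemidef_iff_inner {M : Matrix n n ℝ} :
    M.PosSemidef ↔ M.IsHermitian ∧ ∀ v, 0 ≤ ⟪act M v, v⟫ := by
  rw [← Matrix.isPositive_toEuclideanLin_iff, LinearMap.IsPositive,
    Matrix.isSymmetric_toEuclideanLin_iff]
  rfl

lemma posDef_of_inner {M : Matrix n n ℝ} (hsymm : M.IsHermitian)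
    (h : ∀ v, v ≠ 0 → 0 < ⟪act M v, v⟫) : M.PosDef := by
  refine Matrix.PosDef.of_dotProduct_mulVec_pos hsymm fun v hv => ?_
  have h0 := h (WithLp.toLp 2 v) (by simpa using hv)
  rw [inner_eq_sum] at h0
  simpa [dotProduct, act_apply, Matrix.mulVec, mul_comm] using h0

lemma _root_.Matrix.PosDef.inner_act_pos {M : Matrix n n ℝ} (hM : M.PosDef)
    {v : EuclideanSpace ℝ n} (hv : v ≠ 0) : 0 < ⟪act M v, v⟫ := by
  have h0 := hM.dotProduct_mulVec_pos (x := v.ofLp) (by simpa using hv)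
  rw [inner_eq_sum]
  simpa [dotProduct, act_apply, Matrix.mulVec, mul_comm] using h0

lemma isHermitian_of_inner {M : Matrix n n ℝ} (h : ∀ u v, ⟪act M u, v⟫ = ⟪act M v, u⟫) :
    M.IsHermitian := by
  rw [← Matrix.isSymmetric_toEuclideanLin_iff]
  intro u v
  exact (h u v).trans (real_inner_comm _ _)

lemma _root_.Matrix.IsHermitian.inner_act_comm {M : Matrix n n ℝ} (hM : M.IsHermitian)
    (u v : EuclideanSpace ℝ n) : ⟪act M u, v⟫ = ⟪u, act M v⟫ := by
  rw [inner_act_left, ← Matrix.conjTranspose_eq_transpose_of_trivial, hM.eq]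

open scoped MatrixOrder in
lemma matSqrt_mul_self {M : Matrix n n ℝ} (hM : M.PosSemidef) : matSqrt M * matSqrt M = M :=
  CFC.sqrt_mul_sqrt_self M hM.nonneg

open scoped MatrixOrder in
lemma isHermitian_matSqrt (M : Matrix n n ℝ) : (matSqrt M).IsHermitian :=
  (Matrix.nonneg_iff_posSemidef.1 (CFC.sqrt_nonneg M)).isHermitian

lemma norm_act_matSqrt_sq {M : Matrix n n ℝ} (hM : M.PosSemidef) (v : EuclideanSpace ℝ n) :
    ‖act (matSqrt M) v‖ ^ 2 = ⟪act M v, v⟫ := by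
  rw [← real_inner_self_eq_norm_sq, ← (isHermitian_matSqrt M).inner_act_comm, ← mul_act,
    matSqrt_mul_self hM]

lemma isUnit_matSqrt {M : Matrix n n ℝ} (hM : M.PosDef) : IsUnit (matSqrt M) := by
  have h := hM.isUnit
  rw [← matSqrt_mul_self hM.posSemidef] at h
  exact isUnit_of_mul_isUnit_left h

/-- For a positive semidefinite matrix `B`, `tr B² ≤ ‖B‖ tr B`: write `B = S S` with `S` symmetric,
so that `tr B² = ∑ i, ⟨B S e_i, S e_i⟩`. -/
lemma trace_mul_self_le {B : Matrix n n ℝ} (hB : B.PosSemidef) :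
    (B * B).trace ≤ opNorm B * B.trace := by
  set S := matSqrt B
  have hS : S.transpose = S := by
    simpa [Matrix.conjTranspose_eq_transpose_of_trivial] using (isHermitian_matSqrt B).eq
  have hSS : S * S = B := matSqrt_mul_self hB
  let c : n → EuclideanSpace ℝ n := fun i => WithLp.toLp 2 fun j => S j i
  have h1 : (B * B).trace = ∑ i, ⟪act B (c i), c i⟫ := by
    have : (B * B).trace = (S * (B * S)).trace := by
      conv_lhs => rw [← hSS, Matrix.mul_assoc]
      rw [Matrix.trace_mul_comm S, Matrix.trace_mul_comm S]
      simp only [← hSS, Matrix.mul_assoc]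
    rw [this]
    simp only [Matrix.trace, Matrix.diag, Matrix.mul_apply, inner_eq_sum, act_apply, c]
    refine Finset.sum_congr rfl fun i _ => Finset.sum_congr rfl fun j _ => ?_
    rw [mul_comm, show S i j = S j i from congrFun (congrFun hS j) i]
  have h2 : B.trace = ∑ i, ‖c i‖ ^ 2 := by
    rw [← hSS]
    simp only [Matrix.trace, Matrix.diag, Matrix.mul_apply, norm_sq_eq_sum, c]
    refine Finset.sum_congr rfl fun i _ => Finset.sum_congr rfl fun j _ => ?_
    rw [sq, show S i j = S j i from congrFun (congrFun hS j) i]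
  rw [h1, h2, Finset.mul_sum]
  refine Finset.sum_le_sum fun i _ => (real_inner_le_norm _ _).trans ?_
  nlinarith [norm_act_le B (c i), norm_nonneg (c i)]

lemma zFun_le {B : Matrix n n ℝ} (hB : B.PosSemidef) {x : ℝ} (hx : 0 ≤ x) :
    zFun B x ≤ √B.trace + √(2 * x * opNorm B) := by
  have ht := hB.trace_nonneg
  have ho := opNorm_nonneg B
  refine Real.sqrt_le_iff.2 ⟨by positivity, ?_⟩
  rw [add_sq, Real.sq_sqrt ht, Real.sq_sqrt (by positivity), mul_assoc 2 (√_),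
    ← Real.sqrt_mul ht]
  have : √(x * (B * B).trace) ≤ √(B.trace * (2 * x * opNorm B)) := by
    refine Real.sqrt_le_sqrt ?_
    have h1 : x * (B * B).trace ≤ x * (opNorm B * B.trace) :=
      mul_le_mul_of_nonneg_left (trace_mul_self_le hB) hx
    nlinarith [mul_nonneg hx (mul_nonneg ho ht)]
  linarith

/-- The smallest eigenvalue of a positive definite matrix is positive and bounds its quadratic form
from below. -/
lemma lamMin_spec [Nonempty n] {M : Matrix n n ℝ} (hM : M.PosDef) :
    0 < lamMin M ∧ ∀ v, lamMin M * ‖v‖ ^ 2 ≤ ⟪act M v, v⟫ := by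
  have hspec := hM.1.spectrum_real_eq_range_eigenvalues
  have hfin : (spectrum ℝ M).Finite := hspec ▸ Set.finite_range _
  have hne : (spectrum ℝ M).Nonempty := hspec ▸ Set.range_nonempty _
  refine ⟨?_, fun v => ?_⟩
  · have hmem := hne.csInf_mem hfin
    rw [hspec] at hmem
    obtain ⟨i, hi⟩ := hmem
    rw [lamMin, hspec, ← hi]
    exact hM.eigenvalues_pos i
  · have hherm : (M - algebraMap ℝ (Matrix n n ℝ) (lamMin M)).IsHermitian := by
      refine hM.1.sub ?_
      rw [Algebra.algebraMap_eq_smul_one]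
      exact Matrix.isHermitian_one.smul (IsSelfAdjoint.all _)
    have hpsd : (M - algebraMap ℝ (Matrix n n ℝ) (lamMin M)).PosSemidef := by
      refine Matrix.posSemidef_iff_isHermitian_and_spectrum_nonneg.2 ⟨hherm, ?_⟩
      rw [← spectrum.sub_singleton_eq]
      rintro _ ⟨y, hy, z, rfl, rfl⟩
      exact sub_nonneg.2 (csInf_le hfin.bddBelow hy)
    have := (posSemidef_iff_inner.1 hpsd).2 v
    rw [sub_act, Algebra.algebraMap_eq_smul_one, smul_act, one_act, inner_sub_left,
      real_inner_smul_left, real_inner_self_eq_norm_sq] at this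
    linarith

lemma norm_act_le_frobNorm (M : Matrix m n ℝ) (v : EuclideanSpace ℝ n) :
    ‖act M v‖ ≤ frobNorm M * ‖v‖ := by
  rw [← abs_norm, ← abs_of_nonneg (show 0 ≤ frobNorm M * ‖v‖ from
    mul_nonneg (Real.sqrt_nonneg _) (norm_nonneg _)), ← sq_le_sq, mul_pow, frobNorm,
    Real.sq_sqrt (by positivity), norm_sq_eq_sum, norm_sq_eq_sum, Finset.sum_mul]
  refine Finset.sum_le_sum fun i _ => ?_
  rw [act_apply]
  exact Finset.sum_mul_sq_le_sq_mul_sq _ _ _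

end LinearAlgebra

end ErrInOp

/-! ### The log-likelihood and its derivatives -/

namespace ErrInOp

open scoped RealInnerProductSpace

section Coordinates

variable {p q : ℕ}

@[simp] lemma target_add (u v : Param p q) : target (u + v) = target u + target v := rfl
@[simp] lemma image_add (u v : Param p q) : image (u + v) = image u + image v := rfl
@[simp] lemma oper_add (u v : Param p q) : oper (u + v) = oper u + oper v := rfl
@[simp] lemma target_sub (u v : Param p q) : target (u - v) = target u - target v := rfl
@[simp] lemma target_smul (c : ℝ) (u : Param p q) : target (c • u) = c • target u := rfl
@[simp] lemma image_smul (c : ℝ) (u : Param p q) : image (c • u) = c • image u := rfl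
@[simp] lemma oper_smul (c : ℝ) (u : Param p q) : oper (c • u) = c • oper u := rfl
@[simp] lemma nuis_sub (u v : Param p q) : nuis (u - v) = nuis u - nuis v := rfl
@[simp] lemma target_mkParam (θ : EuclideanSpace ℝ (Fin p)) (ν : Nuis p q) :
    target (mkParam θ ν) = θ := rfl
@[simp] lemma nuis_mkParam (θ : EuclideanSpace ℝ (Fin p)) (ν : Nuis p q) :
    nuis (mkParam θ ν) = ν := rfl
@[simp] lemma image_mkParam (θ : EuclideanSpace ℝ (Fin p)) (η : EuclideanSpace ℝ (Fin q))
    (A : Op p q) : image (mkParam θ (mkNuis η A)) = η := rfl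
@[simp] lemma oper_mkParam (θ : EuclideanSpace ℝ (Fin p)) (η : EuclideanSpace ℝ (Fin q))
    (A : Op p q) : oper (mkParam θ (mkNuis η A)) = A := rfl

lemma mkParam_target_nuis (υ : Param p q) : mkParam (target υ) (nuis υ) = υ := by
  ext i
  rcases i with i | i <;> rfl

lemma mkParam_add (θ θ' : EuclideanSpace ℝ (Fin p)) (ν ν' : Nuis p q) :
    mkParam (θ + θ') (ν + ν') = mkParam θ ν + mkParam θ' ν' := by
  ext i
  rcases i with i | i <;> rfl

lemma inner_param (u v : Param p q) :
    ⟪u, v⟫ = ⟪target u, target v⟫ + ⟪image u, image v⟫ + ⟪oper u, oper v⟫ := by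
  simp only [inner_eq_sum, Fintype.sum_sum_type, add_assoc]
  rfl

lemma inner_param_nuis (u v : Param p q) :
    ⟪u, v⟫ = ⟪target u, target v⟫ + ⟪nuis u, nuis v⟫ := by
  simp only [inner_eq_sum, Fintype.sum_sum_type]
  rfl

lemma norm_param_sq (u : Param p q) :
    ‖u‖ ^ 2 = ‖target u‖ ^ 2 + ‖image u‖ ^ 2 + ‖oper u‖ ^ 2 := by
  simp only [← real_inner_self_eq_norm_sq, inner_param]

/-- The image `A θ` of a vector under an operator. -/
def ap (A : Op p q) (θ : EuclideanSpace ℝ (Fin p)) : EuclideanSpace ℝ (Fin q) := act (toMat A) θ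

@[simp] lemma ap_add (A : Op p q) (u v : EuclideanSpace ℝ (Fin p)) :
    ap A (u + v) = ap A u + ap A v := act_add _ _ _
@[simp] lemma ap_smul (A : Op p q) (c : ℝ) (u : EuclideanSpace ℝ (Fin p)) :
    ap A (c • u) = c • ap A u := act_smul _ _ _
@[simp] lemma add_ap (A B : Op p q) (u : EuclideanSpace ℝ (Fin p)) :
    ap (A + B) u = ap A u + ap B u := add_act _ _ _
@[simp] lemma sub_ap (A B : Op p q) (u : EuclideanSpace ℝ (Fin p)) :
    ap (A - B) u = ap A u - ap B u := sub_act _ _ _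
@[simp] lemma smul_ap (c : ℝ) (A : Op p q) (u : EuclideanSpace ℝ (Fin p)) :
    ap (c • A) u = c • ap A u := smul_act _ _ _

lemma frobNorm_toMat (A : Op p q) : frobNorm (toMat A) = ‖A‖ := by
  rw [frobNorm, EuclideanSpace.norm_eq, Fintype.sum_prod_type]
  simp [toMat]

lemma norm_ap_le (A : Op p q) (u : EuclideanSpace ℝ (Fin p)) : ‖ap A u‖ ≤ ‖A‖ * ‖u‖ :=
  frobNorm_toMat A ▸ norm_act_le_frobNorm (toMat A) u

/-- The residual `η - A θ` of the structural equation. -/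
def res (υ : Param p q) : EuclideanSpace ℝ (Fin q) := image υ - ap (oper υ) (target υ)

/-- The derivative of the residual `η - A θ` at `υ` in the direction `δ`. -/
def lin (υ δ : Param p q) : EuclideanSpace ℝ (Fin q) :=
  image δ - ap (oper υ) (target δ) - ap (oper δ) (target υ)

/-- The part of the residual `η - A θ` that is quadratic in the increment, up to sign. -/
def quad (δ : Param p q) : EuclideanSpace ℝ (Fin q) := ap (oper δ) (target δ)

/-- Twice the polarization of `quad`. -/
def quad₂ (δ u : Param p q) : EuclideanSpace ℝ (Fin q) :=
  ap (oper δ) (target u) + ap (oper u) (target δ)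

lemma res_add (υ δ : Param p q) : res (υ + δ) = res υ + lin υ δ - quad δ := by
  simp only [res, lin, quad, image_add, oper_add, target_add, ap_add, add_ap]
  abel

lemma lin_add_left (υ δ u : Param p q) : lin (υ + δ) u = lin υ u - quad₂ δ u := by
  simp only [lin, quad₂, oper_add, target_add, ap_add, add_ap]
  abel

lemma quad₂_self (δ : Param p q) : quad₂ δ δ = (2 : ℝ) • quad δ := by
  simp only [quad₂, quad, two_smul]

@[simp] lemma lin_smul (υ δ : Param p q) (c : ℝ) : lin υ (c • δ) = c • lin υ δ := by
  simp [lin, smul_sub]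

@[simp] lemma quad_smul (δ : Param p q) (c : ℝ) : quad (c • δ) = (c ^ 2) • quad δ := by
  simp [quad, smul_smul, sq]

@[simp] lemma quad₂_smul_left (δ u : Param p q) (c : ℝ) : quad₂ (c • δ) u = c • quad₂ δ u := by
  simp [quad₂]

@[simp] lemma quad₂_smul_right (δ u : Param p q) (c : ℝ) : quad₂ δ (c • u) = c • quad₂ δ u := by
  simp [quad₂]

lemma contDiff_target {k : WithTop ℕ∞} : ContDiff ℝ k (target : Param p q → _) :=
  contDiff_euclidean.2 fun i => contDiff_piLp_apply (i := Sum.inl i) (p := 2)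

lemma contDiff_image {k : WithTop ℕ∞} : ContDiff ℝ k (image : Param p q → _) :=
  contDiff_euclidean.2 fun i => contDiff_piLp_apply (i := Sum.inr (Sum.inl i)) (p := 2)

lemma contDiff_oper {k : WithTop ℕ∞} : ContDiff ℝ k (oper : Param p q → _) :=
  contDiff_euclidean.2 fun i => contDiff_piLp_apply (i := Sum.inr (Sum.inr i)) (p := 2)

lemma contDiff_res {k : WithTop ℕ∞} : ContDiff ℝ k (res : Param p q → _) := by
  have h1 := contDiff_euclidean.1 (contDiff_target (p := p) (q := q) (k := k))
  have h2 := contDiff_euclidean.1 (contDiff_oper (p := p) (q := q) (k := k))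
  have h3 : ContDiff ℝ k fun υ : Param p q => ap (oper υ) (target υ) :=
    contDiff_euclidean.2 fun i => ContDiff.sum (s := Finset.univ) fun j _ =>
      (h2 (i, j)).mul (h1 j)
  exact contDiff_image.sub h3

end Coordinates

namespace Model

variable {p q : ℕ} {Ω : Type*} [MeasurableSpace Ω] (M : Model p q Ω)

/-- The log-likelihood of the observations `z` and `a`, up to a term that does not depend on `υ`. -/
def loss (z : EuclideanSpace ℝ (Fin q)) (a : Op p q) (υ : Param p q) : ℝ :=
  ⟪z, image υ⟫ - 1 / 2 * ‖image υ‖ ^ 2 + M.μ ^ 2 * ⟪a, oper υ⟫ - M.μ ^ 2 / 2 * ‖oper υ‖ ^ 2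
    - 1 / 2 * ‖res υ‖ ^ 2

/-- The derivative of `loss` at `υ` in the direction `u`. -/
def grad (z : EuclideanSpace ℝ (Fin q)) (a : Op p q) (υ u : Param p q) : ℝ :=
  ⟪z, image u⟫ - ⟪image υ, image u⟫ + M.μ ^ 2 * (⟪a, oper u⟫ - ⟪oper υ, oper u⟫)
    - ⟪res υ, lin υ u⟫

/-- Minus the second derivative of `loss` at `υ` as a bilinear form. -/
def hess (υ δ u : Param p q) : ℝ :=
  ⟪image δ, image u⟫ + M.μ ^ 2 * ⟪oper δ, oper u⟫ + ⟪lin υ δ, lin υ u⟫ - ⟪res υ, quad₂ δ u⟫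

/-- The remainder of the expansion of `grad` at `υ` to first order in the increment `δ`. -/
def cub (υ δ u : Param p q) : ℝ :=
  ⟪quad δ, lin υ u⟫ + ⟪lin υ δ, quad₂ δ u⟫ - ⟪quad δ, quad₂ δ u⟫

/-- The bilinear form of the penalty. -/
def penForm (δ u : Param p q) : ℝ :=
  ⟪act M.G (target δ), act M.G (target u)⟫ + ⟪act M.K (oper δ), act M.K (oper u)⟫

lemma loss_add (z : EuclideanSpace ℝ (Fin q)) (a : Op p q) (υ δ : Param p q) :
    M.loss z a (υ + δ) = M.loss z a υ + M.grad z a υ δ - 1 / 2 * M.hess υ δ δ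
      + (⟪lin υ δ, quad δ⟫ - 1 / 2 * ‖quad δ‖ ^ 2) := by
  simp only [loss, grad, hess, res_add, image_add, oper_add, norm_add_sq_real, norm_sub_sq_real,
    inner_add_right, inner_add_left, real_inner_self_eq_norm_sq, quad₂_self, inner_smul_right]
  ring

lemma grad_add (z : EuclideanSpace ℝ (Fin q)) (a : Op p q) (υ δ u : Param p q) :
    M.grad z a (υ + δ) u = M.grad z a υ u - M.hess υ δ u + cub υ δ u := by
  simp only [grad, hess, cub, res_add, lin_add_left, image_add, oper_add,
    inner_add_left, inner_sub_left, inner_sub_right]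
  ring

lemma pen_add (υ δ : Param p q) :
    M.pen (υ + δ) = M.pen υ + M.penForm υ δ + 1 / 2 * M.penForm δ δ := by
  simp only [pen, penForm, target_add, oper_add, act_add, norm_add_sq_real,
    real_inner_self_eq_norm_sq]
  ring

lemma penForm_add_left (υ δ u : Param p q) :
    M.penForm (υ + δ) u = M.penForm υ u + M.penForm δ u := by
  simp only [penForm, target_add, oper_add, act_add, inner_add_left]
  ring

lemma penForm_smul_left (c : ℝ) (δ u : Param p q) :
    M.penForm (c • δ) u = c * M.penForm δ u := by
  simp only [penForm, target_smul, oper_smul, act_smul, real_inner_smul_left]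
  ring

lemma penForm_smul_right (c : ℝ) (δ u : Param p q) :
    M.penForm δ (c • u) = c * M.penForm δ u := by
  simp only [penForm, target_smul, oper_smul, act_smul, real_inner_smul_right]
  ring

lemma grad_smul (z : EuclideanSpace ℝ (Fin q)) (a : Op p q) (υ u : Param p q) (c : ℝ) :
    M.grad z a υ (c • u) = c * M.grad z a υ u := by
  simp only [grad, image_smul, oper_smul, lin_smul, real_inner_smul_right]
  ring

lemma hess_smul_left (υ δ u : Param p q) (c : ℝ) :
    M.hess υ (c • δ) u = c * M.hess υ δ u := by
  simp only [hess, image_smul, oper_smul, lin_smul, real_inner_smul_left, real_inner_smul_right,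
    quad₂_smul_left]
  ring

lemma hess_smul_right (υ δ u : Param p q) (c : ℝ) :
    M.hess υ δ (c • u) = c * M.hess υ δ u := by
  simp only [hess, image_smul, oper_smul, lin_smul, real_inner_smul_right, quad₂_smul_right]
  ring

lemma loss_line (z : EuclideanSpace ℝ (Fin q)) (a : Op p q) (υ δ : Param p q) (t : ℝ) :
    M.loss z a (υ + t • δ) = M.loss z a υ + t * M.grad z a υ δ - t ^ 2 * (1 / 2 * M.hess υ δ δ)
      + t ^ 3 * ⟪lin υ δ, quad δ⟫ - t ^ 4 * (1 / 2 * ‖quad δ‖ ^ 2) := by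
  rw [loss_add, grad_smul, hess_smul_left, hess_smul_right, lin_smul, quad_smul,
    real_inner_smul_left, real_inner_smul_right, norm_smul, mul_pow, Real.norm_eq_abs, sq_abs]
  ring

lemma grad_line (z : EuclideanSpace ℝ (Fin q)) (a : Op p q) (υ δ u : Param p q) (t : ℝ) :
    M.grad z a (υ + t • δ) u = M.grad z a υ u - t * M.hess υ δ u
      + t ^ 2 * (⟪quad δ, lin υ u⟫ + ⟪lin υ δ, quad₂ δ u⟫) - t ^ 3 * ⟪quad δ, quad₂ δ u⟫ := by
  rw [grad_add, hess_smul_left, cub, lin_smul, quad_smul, quad₂_smul_left]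
  simp only [real_inner_smul_left, real_inner_smul_right]
  ring

lemma contDiff_loss (z : EuclideanSpace ℝ (Fin q)) (a : Op p q) {k : WithTop ℕ∞} :
    ContDiff ℝ k (M.loss z a) := by
  have h1 := contDiff_image (p := p) (q := q) (k := k)
  have h2 := contDiff_oper (p := p) (q := q) (k := k)
  have h3 := contDiff_res (p := p) (q := q) (k := k)
  exact ((((contDiff_const.inner ℝ h1).sub (contDiff_const.mul (h1.norm_sq ℝ))).add
    (contDiff_const.mul (contDiff_const.inner ℝ h2))).sub
    (contDiff_const.mul (h2.norm_sq ℝ))).sub (contDiff_const.mul (h3.norm_sq ℝ))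

lemma hasDerivAt_poly (c₀ c₁ c₂ c₃ c₄ : ℝ) :
    HasDerivAt (fun t : ℝ => c₀ + t * c₁ - t ^ 2 * c₂ + t ^ 3 * c₃ - t ^ 4 * c₄) c₁ 0 := by
  have h := (((((hasDerivAt_const (0 : ℝ) c₀).add ((hasDerivAt_id (0 : ℝ)).mul_const c₁)).sub
    ((hasDerivAt_pow 2 (0 : ℝ)).mul_const c₂)).add
    ((hasDerivAt_pow 3 (0 : ℝ)).mul_const c₃)).sub ((hasDerivAt_pow 4 (0 : ℝ)).mul_const c₄))
  exact h.congr_deriv (by norm_num)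

lemma fderiv_loss (z : EuclideanSpace ℝ (Fin q)) (a : Op p q) (υ u : Param p q) :
    fderiv ℝ (M.loss z a) υ u = M.grad z a υ u := by
  have h1 : HasDerivAt (fun t : ℝ => M.loss z a (υ + t • u)) (fderiv ℝ (M.loss z a) υ u) 0 :=
    (((M.contDiff_loss z a (k := 1)).differentiable one_ne_zero υ).hasFDerivAt).hasLineDerivAt u
  refine h1.unique ?_
  simp only [loss_line]
  exact hasDerivAt_poly _ _ _ _ _

lemma fderiv_fderiv_loss (z : EuclideanSpace ℝ (Fin q)) (a : Op p q) (υ δ u : Param p q) :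
    fderiv ℝ (fderiv ℝ (M.loss z a)) υ δ u = -M.hess υ δ u := by
  have h0 : Differentiable ℝ (fderiv ℝ (M.loss z a)) :=
    ((M.contDiff_loss z a (k := 2)).fderiv_right (m := 1) (by norm_num)).differentiable one_ne_zero
  have h1 : HasDerivAt (fun t : ℝ => fderiv ℝ (M.loss z a) (υ + t • δ) u)
      (fderiv ℝ (fderiv ℝ (M.loss z a)) υ δ u) 0 := by
    have h2 := (h0 υ).hasFDerivAt.hasLineDerivAt δ
    exact h2.clm_apply (hasDerivAt_const (0 : ℝ) u) |>.congr_deriv (by simp)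
  refine h1.unique ?_
  simp only [fderiv_loss, grad_line]
  refine (hasDerivAt_poly (M.grad z a υ u) (-M.hess υ δ u)
    (-(⟪quad δ, lin υ u⟫ + ⟪lin υ δ, quad₂ δ u⟫)) (-⟪quad δ, quad₂ δ u⟫) 0).congr_of_eventuallyEq
    (Filter.Eventually.of_forall fun t => ?_)
  ring

/-- The terms of the log-likelihood that depend on the observations only. -/
def obsTerm (ω : Ω) : ℝ := -(1 / 2) * ‖M.Z ω‖ ^ 2 - M.μ ^ 2 / 2 * ‖M.Ahat ω‖ ^ 2

lemma L_eq (ω : Ω) (υ : Param p q) :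
    M.L ω υ = M.loss (M.Z ω) (M.Ahat ω) υ + M.obsTerm ω := by
  simp only [L, loss, obsTerm, norm_sub_sq_real (M.Z ω), norm_sub_sq_real (oper υ),
    real_inner_comm (M.Ahat ω)]
  rw [res, ap]
  ring

lemma EL_eq [IsProbabilityMeasure M.P] (hZ : MemLp M.Z 2 M.P) (hA : MemLp M.Ahat 2 M.P)
    (υ : Param p q) :
    M.EL υ = M.loss (∫ ω, M.Z ω ∂M.P) (∫ ω, M.Ahat ω ∂M.P) υ + ∫ ω, M.obsTerm ω ∂M.P := by
  have iZ := hZ.integrable one_le_two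
  have iA := hA.integrable one_le_two
  have i1 : Integrable (fun ω => ⟪M.Z ω, image υ⟫) M.P := iZ.inner_const _
  have i2 : Integrable (fun ω => ⟪M.Ahat ω, oper υ⟫) M.P := iA.inner_const _
  have i3 : Integrable M.obsTerm M.P :=
    (hZ.integrable_norm_pow (by norm_num)).const_mul _ |>.sub
      ((hA.integrable_norm_pow (by norm_num)).const_mul _)
  have e1 : ∫ ω, ⟪M.Z ω, image υ⟫ ∂M.P = ⟪∫ ω, M.Z ω ∂M.P, image υ⟫ := by
    simp only [real_inner_comm (image υ)]
    exact integral_inner iZ _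
  have e2 : ∫ ω, ⟪M.Ahat ω, oper υ⟫ ∂M.P = ⟪∫ ω, M.Ahat ω ∂M.P, oper υ⟫ := by
    simp only [real_inner_comm (oper υ)]
    exact integral_inner iA _
  have : ∀ ω, M.L ω υ = (⟪M.Z ω, image υ⟫ + M.μ ^ 2 * ⟪M.Ahat ω, oper υ⟫ + M.obsTerm ω)
      + (- (1 / 2) * ‖image υ‖ ^ 2 - M.μ ^ 2 / 2 * ‖oper υ‖ ^ 2 - 1 / 2 * ‖res υ‖ ^ 2) := by
    intro ω
    rw [L_eq, loss]
    ring
  simp only [EL, this]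
  have i12 : Integrable (fun ω => ⟪M.Z ω, image υ⟫ + M.μ ^ 2 * ⟪M.Ahat ω, oper υ⟫) M.P :=
    i1.add (i2.const_mul _)
  have i123 : Integrable
      (fun ω => ⟪M.Z ω, image υ⟫ + M.μ ^ 2 * ⟪M.Ahat ω, oper υ⟫ + M.obsTerm ω) M.P := i12.add i3
  rw [integral_add i123 (integrable_const _), integral_add i12 i3,
    integral_add i1 (i2.const_mul _), integral_const_mul, e1, e2, loss]
  simp only [integral_const, probReal_univ, one_smul]
  ring

lemma inner_info [IsProbabilityMeasure M.P] (hZ : MemLp M.Z 2 M.P) (hA : MemLp M.Ahat 2 M.P)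
    (υ δ u : Param p q) :
    ⟪act (M.info υ) δ, u⟫ = M.hess υ u δ := by
  have hEL : M.EL = fun υ => M.loss (∫ ω, M.Z ω ∂M.P) (∫ ω, M.Ahat ω ∂M.P) υ
      + ∫ ω, M.obsTerm ω ∂M.P := funext (M.EL_eq hZ hA)
  have hf : fderiv ℝ M.EL = fderiv ℝ (M.loss (∫ ω, M.Z ω ∂M.P) (∫ ω, M.Ahat ω ∂M.P)) := by
    ext1 υ
    rw [hEL, fderiv_add_const]
  have hexp : ∀ v : Param p q, v = ∑ i, v i • EuclideanSpace.single i (1 : ℝ) := fun v => by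
    have := (EuclideanSpace.basisFun (Idx p q) ℝ).sum_repr v
    simpa using this.symm
  rw [← neg_neg (M.hess υ u δ), ← M.fderiv_fderiv_loss (∫ ω, M.Z ω ∂M.P) (∫ ω, M.Ahat ω ∂M.P),
    ← hf]
  conv_rhs => rw [hexp u, hexp δ]
  rw [inner_eq_sum]
  simp only [act_apply, info, Matrix.of_apply, map_sum, map_smul,
    sum_apply, smul_apply, smul_eq_mul, Finset.sum_mul,
    Finset.mul_sum, ← Finset.sum_neg_distrib]
  refine Finset.sum_comm.trans (Finset.sum_congr rfl fun i _ =>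
    Finset.sum_congr rfl fun j _ => ?_)
  ring

lemma target_act_penMat (υ : Param p q) :
    target (act M.penMat υ) = act (M.G.transpose * M.G) (target υ) := by
  ext i
  simp [target, act_apply, penMat, Fintype.sum_sum_type]

lemma image_act_penMat (υ : Param p q) : image (act M.penMat υ) = 0 := by
  ext i
  simp [image, act_apply, penMat, Fintype.sum_sum_type]

lemma oper_act_penMat (υ : Param p q) :
    oper (act M.penMat υ) = act (M.K.transpose * M.K) (oper υ) := by
  ext i
  simp [oper, act_apply, penMat, Fintype.sum_sum_type]

lemma inner_penMat (δ u : Param p q) : ⟪act M.penMat δ, u⟫ = M.penForm δ u := by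
  rw [inner_param, target_act_penMat, image_act_penMat, oper_act_penMat,
    inner_transpose_mul_act, inner_transpose_mul_act, inner_zero_left, penForm, add_zero]

variable (D : Matrix (Fin p) (Fin p) ℝ)

lemma target_act_metric (υ : Param p q) : target (act (M.metric D) υ) = act D (target υ) := by
  ext i
  simp [target, act_apply, metric, Fintype.sum_sum_type]

lemma image_act_metric (υ : Param p q) : image (act (M.metric D) υ) = image υ := by
  ext i
  simp [image, act_apply, metric, metricNuis, Fintype.sum_sum_type, Matrix.one_apply]

lemma oper_act_metric (υ : Param p q) : oper (act (M.metric D) υ) = M.μ • oper υ := by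
  ext i
  simp [oper, act_apply, metric, metricNuis, Fintype.sum_sum_type, Matrix.one_apply]

lemma norm_act_metric_sq (υ : Param p q) : ‖act (M.metric D) υ‖ ^ 2 =
    ‖act D (target υ)‖ ^ 2 + ‖image υ‖ ^ 2 + (M.μ * ‖oper υ‖) ^ 2 := by
  rw [norm_param_sq, target_act_metric, image_act_metric, oper_act_metric, norm_smul, mul_pow,
    mul_pow, Real.norm_eq_abs, sq_abs]

end Model

end ErrInOp

/-! ### Exact expansions and first-order conditions -/

namespace ErrInOp

open scoped RealInnerProductSpace

section ScalarInequalities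

/-- A lower bound for the quadratic form of the information matrix: here `a = ‖D δ_θ‖`,
`b = ‖δ_η‖`, `c = μ ‖δ_A‖`, `A = ‖A* δ_θ‖`, `g = ‖G δ_θ‖` and `w` is the norm of the derivative of
the residual. -/
lemma quarter_le_of_le {A a b c w g : ℝ} (hA : 0 ≤ A) (h1 : a ^ 2 ≤ A ^ 2 + g ^ 2)
    (h2 : A ≤ w + b + 1 / 10 * (a + c)) :
    1 / 4 * (a ^ 2 + b ^ 2 + c ^ 2) + 42 / 100 * (a * c) ≤ b ^ 2 + c ^ 2 + w ^ 2 + g ^ 2 := by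
  have h3 : a ^ 2 - g ^ 2 ≤ (w + b + 1 / 10 * (a + c)) ^ 2 := by
    have := pow_le_pow_left₀ hA h2 2
    linarith
  nlinarith [h3, sq_nonneg (w - 3 / 4 * b), sq_nonneg (w + b - (a + c)), sq_nonneg g,
    sq_nonneg (a - c), sq_nonneg (w + b - a), sq_nonneg (a - 2 * c)]

/-- The analogue of `quarter_le_of_le` on a larger neighborhood, with a smaller constant. -/
lemma tenth_le_of_le {A a b c w g : ℝ} (hA : 0 ≤ A) (h1 : a ^ 2 ≤ A ^ 2 + g ^ 2)
    (h2 : A ≤ w + b + 12 / 100 * (a + c)) :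
    1 / 10 * (a ^ 2 + b ^ 2 + c ^ 2) + 1 / 2 * (a * c) ≤ b ^ 2 + c ^ 2 + w ^ 2 + g ^ 2 := by
  have h3 : a ^ 2 - g ^ 2 ≤ (w + b + 12 / 100 * (a + c)) ^ 2 := by
    have := pow_le_pow_left₀ hA h2 2
    linarith
  nlinarith [h3, sq_nonneg (w - b), sq_nonneg (w + b - (a + c)), sq_nonneg g, sq_nonneg (a - c),
    sq_nonneg (w + b - a), sq_nonneg (a - 2 * c)]

/-- The squared gradient of the cubic form `a c (b + 1.111 a + 0.111 c)` is at most `1.66²` on the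
unit sphere. The first five squares in the proof come from a Gram matrix of the difference of the
two sides, rounded to two digits; the other ones absorb the rounding. -/
lemma norm_grad_cubic_le (a b c : ℝ) :
    (b * c + 2 * (1111 / 1000) * a * c + 111 / 1000 * c ^ 2) ^ 2 + (a * c) ^ 2
      + (a * b + 1111 / 1000 * a ^ 2 + 2 * (111 / 1000) * a * c) ^ 2
      ≤ (166 / 100) ^ 2 * (a ^ 2 + b ^ 2 + c ^ 2) ^ 2 := by
  linarith [sq_nonneg (c ^ 2 - 4 / 100 * (b * c) + 37 / 100 * b ^ 2 - 9 / 100 * (a * c)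
      - 45 / 100 * (a * b) - 21 / 100 * a ^ 2),
    sq_nonneg (b * c + 2 / 100 * b ^ 2 - 41 / 100 * (a * c) + 24 / 100 * (a * b)
      - 12 / 100 * a ^ 2),
    sq_nonneg (b ^ 2 - 23 / 100 * (a * c) + 18 / 100 * (a * b) + 38 / 100 * a ^ 2),
    sq_nonneg (a * c + 273 / 100 * (a * b) - 193 / 100 * a ^ 2),
    sq_nonneg (a * b - 58 / 100 * a ^ 2), sq_nonneg (a * b - a * c), sq_nonneg (a * b + a * c),
    sq_nonneg (a * b - b * c), sq_nonneg (a * b + b * c), sq_nonneg (b * c - a * c),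
    sq_nonneg (b * c + a * c), sq_nonneg (a ^ 2), sq_nonneg (b ^ 2), sq_nonneg (c ^ 2),
    sq_nonneg (a * b), sq_nonneg (a * c), sq_nonneg (b * c), sq_nonneg (a * (a - b)),
    sq_nonneg (a * (a + b)), sq_nonneg (a * (a - c)), sq_nonneg (a * (a + c)),
    sq_nonneg (b * (b - c)), sq_nonneg (b * (b + c)), sq_nonneg (c * (b - c)),
    sq_nonneg (c * (b + c)), sq_nonneg (c * (a - c)), sq_nonneg (c * (a + c)),
    sq_nonneg (b * (b - a)), sq_nonneg (b * (b + a))]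

/-- The polarized form of `norm_grad_cubic_le`. -/
lemma trilinear_scalar_le {a b c a' b' c' y y' : ℝ} (hy : y ^ 2 = a ^ 2 + b ^ 2 + c ^ 2)
    (hy' : y' ^ 2 = a' ^ 2 + b' ^ 2 + c' ^ 2) (hy'0 : 0 ≤ y') :
    a * c * (b' + 1111 / 1000 * a' + 111 / 1000 * c')
      + (b + 1111 / 1000 * a + 111 / 1000 * c) * (c * a' + c' * a) ≤ 166 / 100 * y ^ 2 * y' := by
  have h1 := norm_grad_cubic_le a b c
  set X := b * c + 2 * (1111 / 1000) * a * c + 111 / 1000 * c ^ 2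
  set W := a * b + 1111 / 1000 * a ^ 2 + 2 * (111 / 1000) * a * c
  have h2 : a * c * (b' + 1111 / 1000 * a' + 111 / 1000 * c')
      + (b + 1111 / 1000 * a + 111 / 1000 * c) * (c * a' + c' * a)
      = X * a' + a * c * b' + W * c' := by
    simp only [X, W]
    ring
  rw [h2]
  refine le_of_sq_le_sq ?_ (by positivity)
  rw [mul_pow, mul_pow, hy']
  have h3 : (X * a' + a * c * b' + W * c') ^ 2
      ≤ (X ^ 2 + (a * c) ^ 2 + W ^ 2) * (a' ^ 2 + b' ^ 2 + c' ^ 2) := by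
    linarith [sq_nonneg (X * b' - a * c * a'), sq_nonneg (X * c' - W * a'),
      sq_nonneg (a * c * c' - W * b')]
  rw [hy]
  exact h3.trans (mul_le_mul_of_nonneg_right h1 (by positivity))

lemma nonpos_of_forall_small {ε c₁ c₂ c₃ c₄ : ℝ} (hε : 0 < ε)
    (h : ∀ t, 0 < t → t ≤ ε → t * c₁ - t ^ 2 * c₂ + t ^ 3 * c₃ - t ^ 4 * c₄ ≤ 0) : c₁ ≤ 0 := by
  have hc : ContinuousAt (fun t : ℝ => c₁ - t * c₂ + t ^ 2 * c₃ - t ^ 3 * c₄) 0 := by fun_prop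
  have ht : Filter.Tendsto (fun t : ℝ => c₁ - t * c₂ + t ^ 2 * c₃ - t ^ 3 * c₄)
      (nhdsWithin 0 (Set.Ioi 0)) (nhds c₁) := by
    simpa [ContinuousAt] using hc.tendsto.mono_left (nhdsWithin_le_nhds (s := Set.Ioi 0))
  refine le_of_tendsto ht ?_
  filter_upwards [Ioc_mem_nhdsGT hε] with t ht
  have h1 := h t ht.1 ht.2
  have h2 : t * (c₁ - t * c₂ + t ^ 2 * c₃ - t ^ 3 * c₄) ≤ 0 := by linarith
  exact nonpos_of_mul_nonpos_right h2 ht.1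

end ScalarInequalities

variable {p q : ℕ}

/-- Minus one half of the third derivative of `‖η - A θ‖² / 2` at `υ` along `δ, δ, u`. -/
def tri (υ δ u : Param p q) : ℝ := ⟪quad δ, lin υ u⟫ + ⟪lin υ δ, quad₂ δ u⟫

lemma lin_add_smul (υ δ u : Param p q) (c : ℝ) :
    lin (υ + c • δ) u = lin υ u - c • quad₂ δ u := by
  rw [lin_add_left, quad₂_smul_left]

namespace Model

variable {Ω : Type*} [MeasurableSpace Ω] (M : Model p q Ω)

/-- The penalized version of `loss`. -/
def lossG (z : EuclideanSpace ℝ (Fin q)) (a : Op p q) (υ : Param p q) : ℝ := M.loss z a υ - M.pen υ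

/-- The derivative of `lossG` at `υ` in the direction `u`. -/
def gradG (z : EuclideanSpace ℝ (Fin q)) (a : Op p q) (υ u : Param p q) : ℝ :=
  M.grad z a υ u - M.penForm υ u

/-- Minus the second derivative of `lossG` at `υ`. -/
def hessG (υ δ u : Param p q) : ℝ := M.hess υ δ u + M.penForm δ u

/-- The first-order expansion of the derivative is exact when the third derivative is taken at
`υ + δ / 3`. -/
lemma gradG_add (z : EuclideanSpace ℝ (Fin q)) (a : Op p q) (υ δ u : Param p q) :
    M.gradG z a (υ + δ) u
      = M.gradG z a υ u - M.hessG υ δ u + tri (υ + (1 / 3 : ℝ) • δ) δ u := by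
  simp only [gradG, hessG, grad_add, penForm_add_left, cub, tri, lin_add_smul, quad₂_self,
    inner_sub_left, inner_sub_right, real_inner_smul_left, real_inner_smul_right]
  ring

/-- The second-order expansion is exact when the third derivative is taken at `υ + δ / 4`. -/
lemma lossG_add (z : EuclideanSpace ℝ (Fin q)) (a : Op p q) (υ δ : Param p q) :
    M.lossG z a (υ + δ) = M.lossG z a υ + M.gradG z a υ δ - 1 / 2 * M.hessG υ δ δ
      + 1 / 3 * tri (υ + (1 / 4 : ℝ) • δ) δ δ := by
  simp only [lossG, gradG, hessG, loss_add, pen_add, tri, lin_add_smul, quad₂_self,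
    inner_sub_left, inner_sub_right, real_inner_smul_left, real_inner_smul_right,
    real_inner_self_eq_norm_sq, real_inner_comm (lin υ δ)]
  ring

lemma gradG_smul (z : EuclideanSpace ℝ (Fin q)) (a : Op p q) (υ u : Param p q) (c : ℝ) :
    M.gradG z a υ (c • u) = c * M.gradG z a υ u := by
  rw [gradG, grad_smul, penForm_smul_right, gradG]
  ring

lemma hessG_comm (υ δ u : Param p q) : M.hessG υ δ u = M.hessG υ u δ := by
  simp only [hessG, hess, penForm, quad₂, real_inner_comm (image δ), real_inner_comm (oper δ),
    real_inner_comm (lin υ δ), real_inner_comm (act M.G (target δ)),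
    real_inner_comm (act M.K (oper δ)), add_comm (ap (oper δ) (target u))]

lemma hessG_self (υ δ : Param p q) : M.hessG υ δ δ = ‖image δ‖ ^ 2 + (M.μ * ‖oper δ‖) ^ 2
    + ‖lin υ δ‖ ^ 2 - 2 * ⟪res υ, quad δ⟫ + ‖act M.G (target δ)‖ ^ 2
    + ‖act M.K (oper δ)‖ ^ 2 := by
  simp only [hessG, hess, penForm, quad₂_self, real_inner_smul_right, real_inner_self_eq_norm_sq]
  ring

/-- The increment of the derivative along a segment: the quadratic part is taken at the midpoint of
the segment and the residual is averaged over its end points. -/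
lemma gradG_add_self (z : EuclideanSpace ℝ (Fin q)) (a : Op p q) (υ δ : Param p q) :
    M.gradG z a (υ + δ) δ = M.gradG z a υ δ - (‖image δ‖ ^ 2 + (M.μ * ‖oper δ‖) ^ 2
      + ‖lin (υ + (1 / 2 : ℝ) • δ) δ‖ ^ 2 - ⟪res υ + res (υ + δ), quad δ⟫
      + ‖act M.G (target δ)‖ ^ 2 + ‖act M.K (oper δ)‖ ^ 2) := by
  rw [gradG_add, hessG_self, res_add, tri]
  simp only [lin_add_smul, quad₂_self, inner_add_left, smul_smul, norm_sub_sq_real, norm_smul,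
    inner_sub_left, inner_sub_right, real_inner_smul_left, real_inner_smul_right,
    real_inner_self_eq_norm_sq, real_inner_comm (lin υ δ)]
  norm_num
  ring

/-- At a point where `lossG + ⟨s, ·⟩` does not increase in the direction `v`, its derivative in
this direction is nonpositive. -/
lemma gradG_nonpos (z : EuclideanSpace ℝ (Fin q)) (a : Op p q) (s υ v : Param p q) {ε : ℝ}
    (hε : 0 < ε) (h : ∀ t : ℝ, 0 < t → t ≤ ε →
      M.lossG z a (υ + t • v) + ⟪s, υ + t • v⟫ ≤ M.lossG z a υ + ⟪s, υ⟫) :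
    M.gradG z a υ v + ⟪s, v⟫ ≤ 0 := by
  refine nonpos_of_forall_small (c₂ := 1 / 2 * M.hessG υ v v) (c₃ := ⟪lin υ v, quad v⟫)
    (c₄ := 1 / 2 * ‖quad v‖ ^ 2) hε fun t ht0 ht => ?_
  have h1 := h t ht0 ht
  rw [lossG, loss_line, pen_add, penForm_smul_left, penForm_smul_right, penForm_smul_right,
    inner_add_right, real_inner_smul_right, lossG] at h1
  rw [gradG, hessG]
  linarith

lemma gradG_add_inner_eq_zero {z : EuclideanSpace ℝ (Fin q)} {a : Op p q} {s υ : Param p q}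
    (h : ∀ v, M.gradG z a υ v + ⟪s, v⟫ ≤ 0) (u : Param p q) : M.gradG z a υ u + ⟪s, u⟫ = 0 := by
  refine le_antisymm (h u) ?_
  have := h ((-1 : ℝ) • u)
  rw [gradG_smul, real_inner_smul_right] at this
  linarith

lemma gradG_add_inner_eq_zero_of_max {z : EuclideanSpace ℝ (Fin q)} {a : Op p q} {s υ : Param p q}
    (h : ∀ υ', M.lossG z a υ' + ⟪s, υ'⟫ ≤ M.lossG z a υ + ⟪s, υ⟫) (u : Param p q) :
    M.gradG z a υ u + ⟪s, u⟫ = 0 :=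
  M.gradG_add_inner_eq_zero (fun v => M.gradG_nonpos z a s υ v one_pos fun _ _ _ => h _) u

end Model

end ErrInOp

/-! ### Bounds on the local set -/

namespace ErrInOp

open scoped RealInnerProductSpace

variable {p q : ℕ}

namespace Model

variable {Ω : Type*} [MeasurableSpace Ω] (M : Model p q Ω)

/-- The scale `μ √N` with `N = λ_min(D²)`. -/
def scale (D : Matrix (Fin p) (Fin p) ℝ) : ℝ := M.μ * √(lamMin (D * D))

/-- The standing assumptions on the metric `D` and the operator `A₀`:
`A₀ᵀ A₀ ≤ D² ≤ A₀ᵀ A₀ + G²`. -/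
structure IsAdapted (D : Matrix (Fin p) (Fin p) ℝ) (A₀ : Op p q) : Prop where
  dim_pos : 0 < p
  mu_pos : 0 < M.μ
  posDef : D.PosDef
  low : (D * D - (toMat A₀).transpose * toMat A₀).PosSemidef
  up : ((toMat A₀).transpose * toMat A₀ + M.G.transpose * M.G - D * D).PosSemidef

/-- A neighborhood of the point `(0, 0, A₀)` of relative size `ε`. The distance of the operators is
measured by the operator norm of `(A - A₀) D⁻¹`. -/
structure Near (D : Matrix (Fin p) (Fin p) ℝ) (A₀ : Op p q) (ε : ℝ) (υ : Param p q) : Prop where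
  target_le : ‖act D (target υ)‖ ≤ ε * M.scale D
  image_le : ‖image υ‖ ≤ ε * M.scale D
  oper_le : ∀ a, ‖ap (oper υ - A₀) a‖ ≤ ε * ‖act D a‖

variable {M} {D : Matrix (Fin p) (Fin p) ℝ} {A₀ : Op p q}

namespace IsAdapted

lemma transpose_eq (h : M.IsAdapted D A₀) : D.transpose = D := by
  rw [← Matrix.conjTranspose_eq_transpose_of_trivial, h.posDef.isHermitian.eq]

lemma inner_sq (h : M.IsAdapted D A₀) (a : EuclideanSpace ℝ (Fin p)) :
    ⟪act (D * D) a, a⟫ = ‖act D a‖ ^ 2 := by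
  have := inner_transpose_mul_act D a a
  rwa [h.transpose_eq, real_inner_self_eq_norm_sq] at this

lemma norm_ap_le (h : M.IsAdapted D A₀) (a : EuclideanSpace ℝ (Fin p)) :
    ‖ap A₀ a‖ ≤ ‖act D a‖ := by
  have h1 := (posSemidef_iff_inner.1 h.low).2 a
  rw [sub_act, inner_sub_left, h.inner_sq, inner_transpose_mul_act,
    real_inner_self_eq_norm_sq] at h1
  exact le_of_sq_le_sq (by simpa [ap] using h1) (norm_nonneg _)

lemma norm_sq_le (h : M.IsAdapted D A₀) (a : EuclideanSpace ℝ (Fin p)) :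
    ‖act D a‖ ^ 2 ≤ ‖ap A₀ a‖ ^ 2 + ‖act M.G a‖ ^ 2 := by
  have h1 := (posSemidef_iff_inner.1 h.up).2 a
  rw [sub_act, add_act, inner_sub_left, inner_add_left, h.inner_sq, inner_transpose_mul_act,
    inner_transpose_mul_act, real_inner_self_eq_norm_sq, real_inner_self_eq_norm_sq] at h1
  simpa [ap] using h1

lemma posDef_sq (h : M.IsAdapted D A₀) : (D * D).PosDef := by
  have hu : IsUnit D := h.posDef.isUnit
  have := Matrix.PosDef.conjTranspose_mul_self D (Matrix.mulVec_injective_of_isUnit hu)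
  rwa [h.posDef.isHermitian.eq] at this

lemma scale_pos (h : M.IsAdapted D A₀) : 0 < M.scale D := by
  have : Nonempty (Fin p) := ⟨⟨0, h.dim_pos⟩⟩
  exact mul_pos h.mu_pos (Real.sqrt_pos.2 (lamMin_spec h.posDef_sq).1)

/-- `‖A a‖ ≤ μ ‖A‖ ‖D a‖ / (μ √N)`. -/
lemma scale_mul_norm_ap_le (h : M.IsAdapted D A₀) (A : Op p q) (a : EuclideanSpace ℝ (Fin p)) :
    M.scale D * ‖ap A a‖ ≤ M.μ * ‖A‖ * ‖act D a‖ := by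
  have : Nonempty (Fin p) := ⟨⟨0, h.dim_pos⟩⟩
  obtain ⟨hN, hle⟩ := lamMin_spec h.posDef_sq
  have h1 : √(lamMin (D * D)) * ‖a‖ ≤ ‖act D a‖ := by
    refine le_of_sq_le_sq ?_ (norm_nonneg _)
    rw [mul_pow, Real.sq_sqrt hN.le, ← h.inner_sq]
    exact hle a
  have h2 := ErrInOp.norm_ap_le A a
  have h3 := h.mu_pos.le
  calc M.scale D * ‖ap A a‖ ≤ M.scale D * (‖A‖ * ‖a‖) :=
        mul_le_mul_of_nonneg_left h2 h.scale_pos.le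
    _ = M.μ * ‖A‖ * (√(lamMin (D * D)) * ‖a‖) := by rw [scale]; ring
    _ ≤ _ := mul_le_mul_of_nonneg_left h1 (by positivity)

lemma scale_mul_norm_quad_le (h : M.IsAdapted D A₀) (δ : Param p q) :
    M.scale D * ‖quad δ‖ ≤ ‖act D (target δ)‖ * (M.μ * ‖oper δ‖) := by
  rw [mul_comm ‖act D _‖]
  exact h.scale_mul_norm_ap_le _ _

lemma scale_mul_norm_quad₂_le (h : M.IsAdapted D A₀) (δ u : Param p q) :
    M.scale D * ‖quad₂ δ u‖ ≤ M.μ * ‖oper δ‖ * ‖act D (target u)‖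
      + M.μ * ‖oper u‖ * ‖act D (target δ)‖ := by
  have h1 := norm_add_le (ap (oper δ) (target u)) (ap (oper u) (target δ))
  have h2 := h.scale_mul_norm_ap_le (oper δ) (target u)
  have h3 := h.scale_mul_norm_ap_le (oper u) (target δ)
  have h4 := mul_le_mul_of_nonneg_left h1 h.scale_pos.le
  rw [quad₂]
  linarith

lemma norm_target_le (δ : Param p q) : ‖act D (target δ)‖ ≤ ‖act (M.metric D) δ‖ := by
  refine le_of_sq_le_sq ?_ (norm_nonneg _)
  rw [norm_act_metric_sq]
  linarith [sq_nonneg ‖image δ‖, sq_nonneg (M.μ * ‖oper δ‖)]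

lemma norm_image_le (δ : Param p q) : ‖image δ‖ ≤ ‖act (M.metric D) δ‖ := by
  refine le_of_sq_le_sq ?_ (norm_nonneg _)
  rw [norm_act_metric_sq]
  linarith [sq_nonneg ‖act D (target δ)‖, sq_nonneg (M.μ * ‖oper δ‖)]

lemma norm_oper_le (δ : Param p q) : M.μ * ‖oper δ‖ ≤ ‖act (M.metric D) δ‖ := by
  refine le_of_sq_le_sq ?_ (norm_nonneg _)
  rw [norm_act_metric_sq]
  linarith [sq_nonneg ‖act D (target δ)‖, sq_nonneg ‖image δ‖]

lemma eq_zero_of_norm_le_zero (h : M.IsAdapted D A₀) {δ : Param p q}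
    (hδ : ‖act (M.metric D) δ‖ ≤ 0) : δ = 0 := by
  have h1 : act D (target δ) = 0 := norm_le_zero_iff.1 ((norm_target_le (M := M) δ).trans hδ)
  have h2 : image δ = 0 := norm_le_zero_iff.1 ((norm_image_le (M := M) (D := D) δ).trans hδ)
  have h3 : oper δ = 0 := by
    have h4 := (norm_oper_le (M := M) (D := D) δ).trans hδ
    exact norm_le_zero_iff.1 (nonpos_of_mul_nonpos_right h4 h.mu_pos)
  have h5 : target δ = 0 := by
    rw [← inv_act_act h.posDef.isUnit (target δ), h1, act_zero]
  rw [← norm_le_zero_iff]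
  refine le_of_sq_le_sq ?_ le_rfl
  rw [norm_param_sq, h2, h3, h5]
  simp

end IsAdapted

namespace Near

variable {ε ε₁ ε₂ : ℝ} {υ : Param p q}

lemma add (h : M.IsAdapted D A₀) (hυ : M.Near D A₀ ε υ) {δ : Param p q} {t : ℝ}
    (hδ : ‖act (M.metric D) δ‖ ≤ t * M.scale D) : M.Near D A₀ (ε + t) (υ + δ) := by
  refine ⟨?_, ?_, fun a => ?_⟩
  · have h1 := norm_add_le (act D (target υ)) (act D (target δ))
    have h2 := IsAdapted.norm_target_le (M := M) (D := D) δ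
    rw [target_add, act_add]
    linarith [hυ.target_le]
  · have h1 := norm_add_le (image υ) (image δ)
    have h2 := IsAdapted.norm_image_le (M := M) (D := D) δ
    rw [image_add]
    linarith [hυ.image_le]
  · have h1 := norm_add_le (ap (oper υ - A₀) a) (ap (oper δ) a)
    have h2 : ‖ap (oper δ) a‖ ≤ t * ‖act D a‖ := by
      refine le_of_mul_le_mul_left ?_ h.scale_pos
      calc _ ≤ _ := h.scale_mul_norm_ap_le (oper δ) a
        _ ≤ t * M.scale D * ‖act D a‖ := mul_le_mul_of_nonneg_right
          ((IsAdapted.norm_oper_le (M := M) (D := D) δ).trans hδ) (norm_nonneg _)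
        _ = _ := by ring
    rw [show ap (oper (υ + δ) - A₀) a = ap (oper υ - A₀) a + ap (oper δ) a by
      simp only [oper_add, sub_ap, add_ap]; abel]
    linarith [hυ.oper_le a]

lemma mono (h : M.IsAdapted D A₀) (hυ : M.Near D A₀ ε₁ υ) (hε : ε₁ ≤ ε₂) : M.Near D A₀ ε₂ υ :=
  ⟨hυ.target_le.trans (mul_le_mul_of_nonneg_right hε h.scale_pos.le),
    hυ.image_le.trans (mul_le_mul_of_nonneg_right hε h.scale_pos.le),
    fun a => (hυ.oper_le a).trans (mul_le_mul_of_nonneg_right hε (norm_nonneg _))⟩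

lemma midpoint {υ' : Param p q} (h₁ : M.Near D A₀ ε₁ υ) (h₂ : M.Near D A₀ ε₂ υ') :
    M.Near D A₀ ((ε₁ + ε₂) / 2) (υ + (1 / 2 : ℝ) • (υ' - υ)) := by
  have key : υ + (1 / 2 : ℝ) • (υ' - υ) = (1 / 2 : ℝ) • υ + (1 / 2 : ℝ) • υ' := by module
  have half : ∀ {k : ℕ} (x y : EuclideanSpace ℝ (Fin k)),
      ‖(1 / 2 : ℝ) • x + (1 / 2 : ℝ) • y‖ ≤ (‖x‖ + ‖y‖) / 2 := by
    intro k x y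
    refine (norm_add_le _ _).trans ?_
    rw [norm_smul, norm_smul, Real.norm_of_nonneg (by norm_num)]
    linarith
  rw [key]
  refine ⟨?_, ?_, fun a => ?_⟩
  · simp only [target_add, target_smul, act_add, act_smul]
    refine (half _ _).trans ?_
    linarith [h₁.target_le, h₂.target_le]
  · simp only [image_add, image_smul]
    refine (half _ _).trans ?_
    linarith [h₁.image_le, h₂.image_le]
  · rw [show ap (oper ((1 / 2 : ℝ) • υ + (1 / 2 : ℝ) • υ') - A₀) a
        = (1 / 2 : ℝ) • ap (oper υ - A₀) a + (1 / 2 : ℝ) • ap (oper υ' - A₀) a by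
      simp only [oper_add, oper_smul, sub_ap, add_ap, smul_ap]; module]
    refine (half _ _).trans ?_
    linarith [h₁.oper_le a, h₂.oper_le a]

lemma nonneg (h : M.IsAdapted D A₀) (hυ : M.Near D A₀ ε υ) : 0 ≤ ε :=
  nonneg_of_mul_nonneg_left ((norm_nonneg _).trans hυ.target_le) h.scale_pos

lemma norm_ap_target_le (h : M.IsAdapted D A₀) (hυ : M.Near D A₀ ε υ)
    (δ : Param p q) : ‖ap (oper δ) (target υ)‖ ≤ ε * (M.μ * ‖oper δ‖) := by
  refine le_of_mul_le_mul_left ?_ h.scale_pos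
  have h0 := h.mu_pos.le
  calc _ ≤ _ := h.scale_mul_norm_ap_le (oper δ) (target υ)
    _ ≤ M.μ * ‖oper δ‖ * (ε * M.scale D) :=
      mul_le_mul_of_nonneg_left hυ.target_le (by positivity)
    _ = _ := by ring

lemma norm_ap_oper_le (h : M.IsAdapted D A₀) (hυ : M.Near D A₀ ε υ)
    (a : EuclideanSpace ℝ (Fin p)) : ‖ap (oper υ) a‖ ≤ (1 + ε) * ‖act D a‖ := by
  have h1 := norm_add_le (ap A₀ a) (ap (oper υ - A₀) a)
  rw [← add_ap, add_sub_cancel] at h1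
  linarith [h.norm_ap_le a, hυ.oper_le a]

lemma norm_res_le (h : M.IsAdapted D A₀) (hυ : M.Near D A₀ ε υ) :
    ‖res υ‖ ≤ (ε + (1 + ε) * ε) * M.scale D := by
  have h1 := norm_sub_le (image υ) (ap (oper υ) (target υ))
  have h2 := hυ.norm_ap_oper_le h (target υ)
  have h3 := mul_le_mul_of_nonneg_left hυ.target_le (by linarith [hυ.nonneg h] : 0 ≤ 1 + ε)
  rw [res]
  linarith [hυ.image_le]

lemma norm_lin_le (h : M.IsAdapted D A₀) (hυ : M.Near D A₀ ε υ) (δ : Param p q) :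
    ‖lin υ δ‖ ≤ ‖image δ‖ + (1 + ε) * ‖act D (target δ)‖ + ε * (M.μ * ‖oper δ‖) := by
  have h1 := norm_sub_le (image δ - ap (oper υ) (target δ)) (ap (oper δ) (target υ))
  have h2 := norm_sub_le (image δ) (ap (oper υ) (target δ))
  rw [lin]
  linarith [hυ.norm_ap_oper_le h (target δ), hυ.norm_ap_target_le h δ]

lemma norm_ap_le_lin (h : M.IsAdapted D A₀) (hυ : M.Near D A₀ ε υ) (δ : Param p q) :
    ‖ap A₀ (target δ)‖
      ≤ ‖lin υ δ‖ + ‖image δ‖ + ε * (‖act D (target δ)‖ + M.μ * ‖oper δ‖) := by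
  have key : ap A₀ (target δ)
      = image δ - lin υ δ - ap (oper δ) (target υ) - ap (oper υ - A₀) (target δ) := by
    simp only [lin, sub_ap]
    abel
  have h1 := norm_sub_le (image δ - lin υ δ - ap (oper δ) (target υ)) (ap (oper υ - A₀) (target δ))
  have h2 := norm_sub_le (image δ - lin υ δ) (ap (oper δ) (target υ))
  have h3 := norm_sub_le (image δ) (lin υ δ)
  rw [key]
  linarith [hυ.norm_ap_target_le h δ, hυ.oper_le (target δ)]

/-- The third derivative is bounded in the metric `𝒟`. The bound is uniform in the two arguments,
so it also controls the remainder in the expansion of the gradient. -/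
lemma scale_mul_abs_tri_le (h : M.IsAdapted D A₀) (hυ : M.Near D A₀ (111 / 1000) υ)
    (δ u : Param p q) : M.scale D * |tri υ δ u|
      ≤ 166 / 100 * ‖act (M.metric D) δ‖ ^ 2 * ‖act (M.metric D) u‖ := by
  refine le_trans ?_ (trilinear_scalar_le (norm_act_metric_sq M D δ) (norm_act_metric_sq M D u)
    (norm_nonneg _))
  have hS := h.scale_pos
  have h0 := h.mu_pos.le
  have h1 : |tri υ δ u| ≤ ‖quad δ‖ * ‖lin υ u‖ + ‖lin υ δ‖ * ‖quad₂ δ u‖ :=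
    (abs_add_le _ _).trans (add_le_add (abs_real_inner_le_norm _ _) (abs_real_inner_le_norm _ _))
  have h2 := hυ.norm_lin_le h u
  have h3 := hυ.norm_lin_le h δ
  calc M.scale D * |tri υ δ u|
      ≤ M.scale D * (‖quad δ‖ * ‖lin υ u‖ + ‖lin υ δ‖ * ‖quad₂ δ u‖) :=
        mul_le_mul_of_nonneg_left h1 hS.le
    _ = M.scale D * ‖quad δ‖ * ‖lin υ u‖ + ‖lin υ δ‖ * (M.scale D * ‖quad₂ δ u‖) := by ring
    _ ≤ _ := ?_
  refine add_le_add ?_ ?_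
  · refine mul_le_mul (h.scale_mul_norm_quad_le δ) ?_ (norm_nonneg _) (by positivity)
    linarith
  · refine mul_le_mul ?_ (h.scale_mul_norm_quad₂_le δ u) (by positivity) (by positivity)
    linarith

lemma quarter_le_hessG (h : M.IsAdapted D A₀) (hυ : M.Near D A₀ (1 / 10) υ) (δ : Param p q) :
    1 / 4 * ‖act (M.metric D) δ‖ ^ 2 + ‖act M.K (oper δ)‖ ^ 2 ≤ M.hessG υ δ δ := by
  have h1 := quarter_le_of_le (norm_nonneg _) (h.norm_sq_le (target δ)) (hυ.norm_ap_le_lin h δ)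
  have h2 : ⟪res υ, quad δ⟫ ≤ 21 / 100 * (‖act D (target δ)‖ * (M.μ * ‖oper δ‖)) := by
    calc _ ≤ ‖res υ‖ * ‖quad δ‖ := real_inner_le_norm _ _
      _ ≤ 21 / 100 * M.scale D * ‖quad δ‖ := by
        refine mul_le_mul_of_nonneg_right ((hυ.norm_res_le h).trans (le_of_eq ?_)) (norm_nonneg _)
        norm_num
      _ ≤ _ := by linarith [h.scale_mul_norm_quad_le δ]
  rw [hessG_self, norm_act_metric_sq]
  linarith

/-- Uniqueness of the critical point: the derivative of `lossG` is strictly monotone between two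
points that are near `(0, 0, A₀)`. -/
lemma eq_of_gradG_eq (h : M.IsAdapted D A₀) {υ₁ : Param p q} (hυ : M.Near D A₀ (132 / 1000) υ)
    (hυ₁ : M.Near D A₀ (1 / 10) υ₁) {z : EuclideanSpace ℝ (Fin q)} {a : Op p q}
    (heq : M.gradG z a υ₁ (υ₁ - υ) = M.gradG z a υ (υ₁ - υ)) : υ₁ = υ := by
  set δ := υ₁ - υ
  have hadd : υ + δ = υ₁ := add_sub_cancel _ _
  have hmid : M.Near D A₀ (12 / 100) (υ + (1 / 2 : ℝ) • δ) :=
    (hυ.midpoint hυ₁).mono h (by norm_num)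
  have h1 := tenth_le_of_le (norm_nonneg _) (h.norm_sq_le (target δ)) (hmid.norm_ap_le_lin h δ)
  have h2 : ⟪res υ + res υ₁, quad δ⟫ ≤ 1 / 2 * (‖act D (target δ)‖ * (M.μ * ‖oper δ‖)) := by
    calc _ ≤ ‖res υ + res υ₁‖ * ‖quad δ‖ := real_inner_le_norm _ _
      _ ≤ 1 / 2 * M.scale D * ‖quad δ‖ := by
        refine mul_le_mul_of_nonneg_right ((norm_add_le _ _).trans ?_) (norm_nonneg _)
        nlinarith [hυ.norm_res_le h, hυ₁.norm_res_le h, h.scale_pos]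
      _ ≤ _ := by linarith [h.scale_mul_norm_quad_le δ]
  have h3 := M.gradG_add_self z a υ δ
  rw [hadd, heq] at h3
  have h4 : ‖act (M.metric D) δ‖ ^ 2 ≤ 0 := by
    rw [norm_act_metric_sq]
    nlinarith [sq_nonneg ‖act M.K (oper δ)‖]
  have h5 : δ = 0 := h.eq_zero_of_norm_le_zero
    (le_of_sq_le_sq (by simpa using h4) le_rfl)
  exact sub_eq_zero.1 h5

end Near

end Model

end ErrInOp

/-! ### The effect of a linear perturbation -/

namespace ErrInOp

open scoped RealInnerProductSpace

variable {p q : ℕ}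

namespace Model

variable {Ω : Type*} [MeasurableSpace Ω] {M : Model p q Ω}
  {D : Matrix (Fin p) (Fin p) ℝ} {A₀ : Op p q}

lemma inner_infoG [IsProbabilityMeasure M.P] (hZ : MemLp M.Z 2 M.P) (hA : MemLp M.Ahat 2 M.P)
    (υ δ u : Param p q) : ⟪act (M.infoG υ) δ, u⟫ = M.hessG υ δ u := by
  rw [hessG_comm, infoG, add_act, inner_add_left, M.inner_info hZ hA, inner_penMat, hessG,
    ← inner_penMat M δ u, ← inner_penMat M u δ, inner_penMat, inner_penMat, penForm, penForm,
    real_inner_comm (act M.G _), real_inner_comm (act M.K _)]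

lemma Near.posDef_infoG [IsProbabilityMeasure M.P] (hZ : MemLp M.Z 2 M.P)
    (hA : MemLp M.Ahat 2 M.P) (h : M.IsAdapted D A₀) {υ : Param p q}
    (hυ : M.Near D A₀ (1 / 10) υ) : (M.infoG υ).PosDef := by
  refine posDef_of_inner (isHermitian_of_inner fun u v => ?_) fun v hv => ?_
  · rw [inner_infoG hZ hA, inner_infoG hZ hA, hessG_comm]
  · rw [inner_infoG hZ hA]
    have h1 := hυ.quarter_le_hessG h v
    have h2 : 0 < ‖act (M.metric D) v‖ := by
      by_contra hcon
      exact hv (h.eq_zero_of_norm_le_zero (not_lt.1 hcon))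
    have h3 : 0 < ‖act (M.metric D) v‖ ^ 2 := by positivity
    linarith [sq_nonneg ‖act M.K (oper v)‖]

lemma hessG_inv_infoG [IsProbabilityMeasure M.P] (hZ : MemLp M.Z 2 M.P)
    (hA : MemLp M.Ahat 2 M.P) (h : M.IsAdapted D A₀) {υ : Param p q}
    (hυ : M.Near D A₀ (1 / 10) υ) (s u : Param p q) :
    M.hessG υ (act (M.infoG υ)⁻¹ s) u = ⟪s, u⟫ := by
  rw [← inner_infoG hZ hA, act_inv_act (hυ.posDef_infoG hZ hA h).isUnit]

lemma Near.norm_metric_le (h : M.IsAdapted D A₀) {υ e : Param p q}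
    (hυ : M.Near D A₀ (1 / 10) υ) {c : ℝ} (hc : 0 ≤ c)
    (he : ∀ u, M.hessG υ e u ≤ c * ‖act (M.metric D) u‖) :
    ‖act (M.metric D) e‖ ≤ 4 * c := by
  have h1 := hυ.quarter_le_hessG h e
  have h2 := he e
  by_contra! hcon
  nlinarith [norm_nonneg (act (M.metric D) e), sq_nonneg ‖act M.K (oper e)‖]

lemma isCompact_metric_ball (h : M.IsAdapted D A₀) (r : ℝ) :
    IsCompact {δ : Param p q | ‖act (M.metric D) δ‖ ≤ r} := by
  have hker : LinearMap.ker (Matrix.toEuclideanLin (M.metric D)) = ⊥ :=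
    LinearMap.ker_eq_bot'.2 fun δ hδ =>
      h.eq_zero_of_norm_le_zero (M := M) (by rw [show act (M.metric D) δ = 0 from hδ, norm_zero])
  obtain ⟨K, -, hK⟩ := LinearMap.exists_antilipschitzWith _ hker
  refine Metric.isCompact_of_isClosed_isBounded
    (isClosed_le (continuous_act _).norm continuous_const) ?_
  have := hK.isBounded_preimage (Metric.isBounded_closedBall (x := 0) (r := r))
  refine this.subset fun δ hδ => ?_
  simpa [act] using hδ

lemma continuous_lossG (z : EuclideanSpace ℝ (Fin q)) (a : Op p q) :
    Continuous (M.lossG z a) := by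
  refine (M.contDiff_loss z a (k := 0)).continuous.sub ?_
  have h1 : Continuous (target : Param p q → _) := (contDiff_target (k := 0)).continuous
  have h2 : Continuous (oper : Param p q → _) := (contDiff_oper (k := 0)).continuous
  exact (continuous_const.mul (((continuous_act _).comp h1).norm.pow 2)).add
    (continuous_const.mul (((continuous_act _).comp h2).norm.pow 2))

/-- A linear perturbation `⟨s, ·⟩` of `lossG` has a critical point at distance at most
`1.265 ‖𝒟 𝔽_𝒢⁻¹ s‖` from a critical point of `lossG`. A maximizer over the ball of this radius
cannot lie on the sphere: at a point `υ + δ` of the sphere, the objective increases in the inward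
direction `-𝔽_𝒢⁻¹ 𝒟² δ`.

The factor `ρ = 1.265` has to satisfy `4 · 1.66 · (2 / 81) ρ² < ρ - 1` here, `4 · 1.66 ρ² ≤ 27 / 2`
in `critical_expansion` and `(2 / 3) · 1.66 ρ³ ≤ 9 / 4` in `maximum_expansion`. -/
lemma exists_critical [IsProbabilityMeasure M.P] (hZ : MemLp M.Z 2 M.P)
    (hA : MemLp M.Ahat 2 M.P) (h : M.IsAdapted D A₀) {υ : Param p q}
    (hυ : M.Near D A₀ (1 / 10) υ) {z : EuclideanSpace ℝ (Fin q)} {a : Op p q}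
    (h0 : ∀ u, M.gradG z a υ u = 0) (s : Param p q)
    (hs : 81 * ‖act (M.metric D) (act (M.infoG υ)⁻¹ s)‖ < 2 * M.scale D) :
    ∃ δ, ‖act (M.metric D) δ‖ ≤ 1265 / 1000 * ‖act (M.metric D) (act (M.infoG υ)⁻¹ s)‖ ∧
      ∀ u, M.gradG z a (υ + δ) u + ⟪s, u⟫ = 0 := by
  have hU := (hυ.posDef_infoG hZ hA h).isUnit
  have hS := h.scale_pos
  set w := act (M.infoG υ)⁻¹ s
  have hw : ∀ u, M.hessG υ w u = ⟪s, u⟫ := hessG_inv_infoG hZ hA h hυ s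
  set n := ‖act (M.metric D) w‖
  have hn0 : 0 ≤ n := norm_nonneg _
  rcases hn0.eq_or_lt with hn | hn
  · have hw0 : w = 0 := h.eq_zero_of_norm_le_zero hn.ge
    refine ⟨0, by simp [← hn], fun u => ?_⟩
    rw [add_zero, h0, ← hw, hw0, ← inner_infoG hZ hA, act_zero, inner_zero_left, add_zero]
  set r := 1265 / 1000 * n
  have hr : 0 < r := by positivity
  obtain ⟨δ, hδ, hmax⟩ := (isCompact_metric_ball h r).exists_isMaxOn ⟨0, by simp [hr.le]⟩
    (f := fun δ => M.lossG z a (υ + δ) + ⟪s, υ + δ⟫)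
    (((continuous_lossG z a).comp (continuous_const.add continuous_id)).add
      (continuous_const.inner (continuous_const.add continuous_id))).continuousOn
  refine ⟨δ, hδ, ?_⟩
  -- first-order condition in a direction that does not leave the ball
  have hdir : ∀ (v : Param p q) {ε : ℝ}, 0 < ε →
      (∀ t : ℝ, 0 < t → t ≤ ε → ‖act (M.metric D) (δ + t • v)‖ ≤ r) →
      M.gradG z a (υ + δ) v + ⟪s, v⟫ ≤ 0 := fun v ε hε hv =>
    M.gradG_nonpos z a s (υ + δ) v hε fun t ht0 ht => by
      have := hmax (hv t ht0 ht)
      simpa [add_assoc] using this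
  rcases (show ‖act (M.metric D) δ‖ ≤ r from hδ).eq_or_lt with hy | hy
  · exfalso
    set v := -act (M.infoG υ)⁻¹ (act ((M.metric D).transpose * M.metric D) δ)
    have hv : ∀ u, M.hessG υ v u = -⟪act (M.metric D) δ, act (M.metric D) u⟫ := fun u => by
      rw [← inner_infoG hZ hA, act_neg, act_inv_act hU, inner_neg_left, inner_transpose_mul_act]
    have hvn : ‖act (M.metric D) v‖ ≤ 4 * r := hυ.norm_metric_le h hr.le fun u => by
      rw [hv, ← hy]
      exact (neg_le_abs _).trans (abs_real_inner_le_norm _ _)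
    have hvv : 1 / 4 * ‖act (M.metric D) v‖ ^ 2 ≤ -⟪act (M.metric D) δ, act (M.metric D) v⟫ := by
      rw [← hv]
      linarith [hυ.quarter_le_hessG h v, sq_nonneg ‖act M.K (oper v)‖]
    have h1 := hdir v (ε := 1 / 2) (by norm_num) fun t ht0 ht => by
      refine le_of_sq_le_sq ?_ hr.le
      rw [act_add, act_smul, norm_add_sq_real, real_inner_smul_right, norm_smul, mul_pow,
        Real.norm_eq_abs, sq_abs, hy]
      have h2 : t * (t * ‖act (M.metric D) v‖ ^ 2) ≤ t * (1 / 2 * ‖act (M.metric D) v‖ ^ 2) :=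
        mul_le_mul_of_nonneg_left (mul_le_mul_of_nonneg_right ht (sq_nonneg _)) ht0.le
      have h3 := mul_le_mul_of_nonneg_left hvv ht0.le
      linarith
    have hnear : M.Near D A₀ (111 / 1000) (υ + (1 / 3 : ℝ) • δ) :=
      (hυ.add h (t := 11 / 1000) (by
        rw [act_smul, norm_smul, hy, Real.norm_of_nonneg (by norm_num)]
        simp only [r]
        linarith)).mono h (by norm_num)
    have h4 := hnear.scale_mul_abs_tri_le h δ v
    rw [gradG_add, h0, hessG_comm, hv, real_inner_self_eq_norm_sq, hy, ← hw, hessG_comm, hv] at h1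
    have h5 : ⟪act (M.metric D) δ, act (M.metric D) w⟫ ≤ r * n := by
      rw [← hy]
      exact real_inner_le_norm _ _
    have h6 : M.scale D * |tri (υ + (1 / 3 : ℝ) • δ) δ v| ≤ 664 / 100 * r ^ 3 := by
      refine h4.trans ?_
      rw [hy]
      nlinarith [mul_le_mul_of_nonneg_left hvn (sq_nonneg r)]
    have h7 : M.scale D * (r ^ 2 - r * n) ≤ 664 / 100 * r ^ 3 := by
      refine le_trans ?_ h6
      refine mul_le_mul_of_nonneg_left ?_ hS.le
      linarith [neg_abs_le (tri (υ + (1 / 3 : ℝ) • δ) δ v)]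
    have h8 : 0 < n ^ 2 := by positivity
    have h9 : n ^ 2 * (81 * n) < n ^ 2 * (2 * M.scale D) := mul_lt_mul_of_pos_left hs h8
    simp only [r] at h7
    nlinarith [mul_pos h8 hS]
  · refine M.gradG_add_inner_eq_zero fun v => ?_
    have h1 : 0 < 1 + ‖act (M.metric D) v‖ := by positivity
    refine hdir v (ε := (r - ‖act (M.metric D) δ‖) / (1 + ‖act (M.metric D) v‖))
      (div_pos (sub_pos.2 hy) h1) fun t ht0 ht => ?_
    rw [le_div_iff₀ h1] at ht
    rw [act_add, act_smul]
    refine (norm_add_le _ _).trans ?_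
    rw [norm_smul, Real.norm_of_nonneg ht0.le]
    linarith

/-- If `υ` is a critical point of `lossG` and `υ₁` a critical point of `lossG + ⟨s, ·⟩`, then
`υ₁ - υ` is `𝔽_𝒢⁻¹ s` up to an error that is quadratic in `𝒟 𝔽_𝒢⁻¹ s`. -/
theorem critical_expansion [IsProbabilityMeasure M.P] (hZ : MemLp M.Z 2 M.P)
    (hA : MemLp M.Ahat 2 M.P) (h : M.IsAdapted D A₀) {υ υ₁ : Param p q}
    (hυ : M.Near D A₀ (1 / 10) υ) (hυ₁ : M.Near D A₀ (1 / 10) υ₁)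
    {z : EuclideanSpace ℝ (Fin q)} {a : Op p q}
    (h0 : ∀ u, M.gradG z a υ u = 0) {s : Param p q}
    (h1 : ∀ u, M.gradG z a υ₁ u + ⟪s, u⟫ = 0)
    (hs : 81 * ‖act (M.metric D) (act (M.infoG υ)⁻¹ s)‖ < 2 * M.scale D) :
    ‖act (M.metric D) (υ₁ - υ)‖ ≤ 1265 / 1000 * ‖act (M.metric D) (act (M.infoG υ)⁻¹ s)‖ ∧
      M.scale D * ‖act (M.metric D) (υ₁ - υ - act (M.infoG υ)⁻¹ s)‖
        ≤ 27 / 2 * ‖act (M.metric D) (act (M.infoG υ)⁻¹ s)‖ ^ 2 := by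
  obtain ⟨δ, hδ, hcrit⟩ := exists_critical hZ hA h hυ h0 s hs
  have hS := h.scale_pos
  have hw := hessG_inv_infoG hZ hA h hυ s
  set w := act (M.infoG υ)⁻¹ s
  set n := ‖act (M.metric D) w‖
  have hn0 : 0 ≤ n := norm_nonneg _
  have huniq : υ₁ = υ + δ := by
    refine ((hυ.add h (t := 32 / 1000) (by linarith)).mono h (by norm_num)).eq_of_gradG_eq h hυ₁
      (z := z) (a := a) ?_
    linarith [h1 (υ₁ - (υ + δ)), hcrit (υ₁ - (υ + δ))]
  have hdiff : υ₁ - υ = δ := by rw [huniq, add_sub_cancel_left]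
  rw [hdiff]
  refine ⟨hδ, ?_⟩
  have hnear : M.Near D A₀ (111 / 1000) (υ + (1 / 3 : ℝ) • δ) :=
    (hυ.add h (t := 11 / 1000) (by
      rw [act_smul, norm_smul, Real.norm_of_nonneg (by norm_num)]
      linarith)).mono h (by norm_num)
  have h2 : ‖act (M.metric D) (δ - w)‖
      ≤ 4 * (166 / 100 * ‖act (M.metric D) δ‖ ^ 2 / M.scale D) := by
    refine hυ.norm_metric_le h (by positivity) fun u => ?_
    have h3 := hcrit u
    rw [gradG_add, h0, ← hw] at h3
    have h4 : M.hessG υ (δ - w) u = tri (υ + (1 / 3 : ℝ) • δ) δ u := by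
      rw [← inner_infoG hZ hA, act_sub, inner_sub_left, inner_infoG hZ hA, inner_infoG hZ hA]
      linarith
    have h5 := hnear.scale_mul_abs_tri_le h δ u
    rw [h4, div_mul_eq_mul_div, le_div_iff₀ hS]
    nlinarith [le_abs_self (tri (υ + (1 / 3 : ℝ) • δ) δ u)]
  have h3 : ‖act (M.metric D) δ‖ ^ 2 ≤ (1265 / 1000 * n) ^ 2 :=
    pow_le_pow_left₀ (norm_nonneg _) hδ 2
  have h4 := mul_le_mul_of_nonneg_left h2 hS.le
  rw [show M.scale D * (4 * (166 / 100 * ‖act (M.metric D) δ‖ ^ 2 / M.scale D))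
    = 664 / 100 * ‖act (M.metric D) δ‖ ^ 2 by field_simp; ring] at h4
  nlinarith [sq_nonneg n]

/-- The expansion of the maximum of `lossG + ⟨s, ·⟩`. -/
theorem maximum_expansion [IsProbabilityMeasure M.P] (hZ : MemLp M.Z 2 M.P)
    (hA : MemLp M.Ahat 2 M.P) (h : M.IsAdapted D A₀) {υ υ₁ : Param p q}
    (hυ : M.Near D A₀ (1 / 10) υ) (hυ₁ : M.Near D A₀ (1 / 10) υ₁)
    {z : EuclideanSpace ℝ (Fin q)} {a : Op p q}
    (h0 : ∀ u, M.gradG z a υ u = 0) {s : Param p q}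
    (h1 : ∀ υ', M.lossG z a υ' + ⟪s, υ'⟫ ≤ M.lossG z a υ₁ + ⟪s, υ₁⟫)
    (hs : 81 * ‖act (M.metric D) (act (M.infoG υ)⁻¹ s)‖ < 2 * M.scale D) :
    M.scale D * |2 * (M.lossG z a υ₁ + ⟪s, υ₁⟫) - 2 * (M.lossG z a υ + ⟪s, υ⟫)
        - ⟪s, act (M.infoG υ)⁻¹ s⟫|
      ≤ 9 / 4 * ‖act (M.metric D) (act (M.infoG υ)⁻¹ s)‖ ^ 3 := by
  obtain ⟨hδ, -⟩ := critical_expansion hZ hA h hυ hυ₁ h0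
    (M.gradG_add_inner_eq_zero_of_max h1) hs
  have hS := h.scale_pos
  have hw := hessG_inv_infoG hZ hA h hυ s
  set w := act (M.infoG υ)⁻¹ s
  set n := ‖act (M.metric D) w‖
  have hn0 : 0 ≤ n := norm_nonneg _
  set δ := υ₁ - υ
  have hυ₁' : υ₁ = υ + δ := (add_sub_cancel _ _).symm
  -- the third-order remainder at an increment of size at most `1.265 n`
  have hrem : ∀ d : Param p q, ‖act (M.metric D) d‖ ≤ 1265 / 1000 * n →
      M.scale D * |tri (υ + (1 / 4 : ℝ) • d) d d| ≤ 27 / 8 * n ^ 3 := fun d hd => by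
    have hnear : M.Near D A₀ (111 / 1000) (υ + (1 / 4 : ℝ) • d) :=
      (hυ.add h (t := 11 / 1000) (by
        rw [act_smul, norm_smul, Real.norm_of_nonneg (by norm_num)]
        linarith)).mono h (by norm_num)
    have h2 := hnear.scale_mul_abs_tri_le h d d
    have h3 := pow_le_pow_left₀ (norm_nonneg _) hd 3
    have h4 : 0 ≤ n ^ 3 := by positivity
    nlinarith
  have hval : ∀ d : Param p q, 2 * (M.lossG z a (υ + d) + ⟪s, υ + d⟫)
      = 2 * (M.lossG z a υ + ⟪s, υ⟫) + ⟪s, w⟫ - M.hessG υ (d - w) (d - w)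
        + 2 / 3 * tri (υ + (1 / 4 : ℝ) • d) d d := fun d => by
    have h2 : M.hessG υ (d - w) (d - w) = M.hessG υ d d - 2 * ⟪s, d⟫ + ⟪s, w⟫ := by
      rw [← inner_infoG hZ hA, act_sub, inner_sub_left, inner_sub_right, inner_sub_right,
        inner_infoG hZ hA, inner_infoG hZ hA, inner_infoG hZ hA, inner_infoG hZ hA,
        M.hessG_comm υ d w, hw, hw]
      ring
    rw [lossG_add, h0, h2, inner_add_right]
    ring
  have hup := hval δ
  have hlow := hval w
  have h2 := h1 (υ + w)
  rw [← hυ₁'] at hup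
  have h3 := hrem δ hδ
  have h4 := hrem w (by linarith)
  have h5 := hυ.quarter_le_hessG h (δ - w)
  have h6 : M.hessG υ (w - w) (w - w) = 0 := by
    rw [sub_self, ← inner_infoG hZ hA, act_zero, inner_zero_left]
  rw [← abs_of_pos hS, ← abs_mul, abs_le]
  constructor
  · have h7 : 2 / 3 * tri (υ + (1 / 4 : ℝ) • w) w w
        ≤ 2 * (M.lossG z a υ₁ + ⟪s, υ₁⟫) - 2 * (M.lossG z a υ + ⟪s, υ⟫) - ⟪s, w⟫ := by linarith
    have h8 := mul_le_mul_of_nonneg_left h7 hS.le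
    have h9 := mul_le_mul_of_nonneg_left (neg_abs_le (tri (υ + (1 / 4 : ℝ) • w) w w)) hS.le
    linarith
  · have h7 : 2 * (M.lossG z a υ₁ + ⟪s, υ₁⟫) - 2 * (M.lossG z a υ + ⟪s, υ⟫) - ⟪s, w⟫
        ≤ 2 / 3 * tri (υ + (1 / 4 : ℝ) • δ) δ δ := by
      linarith [sq_nonneg ‖act (M.metric D) (δ - w)‖, sq_nonneg ‖act M.K (oper (δ - w))‖]
    have h8 := mul_le_mul_of_nonneg_left h7 hS.le
    have h9 := mul_le_mul_of_nonneg_left (le_abs_self (tri (υ + (1 / 4 : ℝ) • δ) δ δ)) hS.le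
    linarith

end Model

end ErrInOp

/-! ### The stochastic term and the profile log-likelihood -/

namespace ErrInOp

open scoped RealInnerProductSpace

variable {p q : ℕ}

section Schur

lemma target_act_eq (F : Matrix (Idx p q) (Idx p q) ℝ) (υ : Param p q) :
    target (act F υ) = act F.toBlocks₁₁ (target υ) + act F.toBlocks₁₂ (nuis υ) := by
  ext i
  simp only [target, nuis, act_apply, PiLp.add_apply]
  exact Fintype.sum_sum_type _

lemma nuis_act_eq (F : Matrix (Idx p q) (Idx p q) ℝ) (υ : Param p q) :
    nuis (act F υ) = act F.toBlocks₂₁ (target υ) + act F.toBlocks₂₂ (nuis υ) := by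
  ext i
  simp only [target, nuis, act_apply, PiLp.add_apply]
  exact Fintype.sum_sum_type _

variable {F : Matrix (Idx p q) (Idx p q) ℝ}

lemma posDef_toBlocks₂₂ (hF : F.PosDef) : F.toBlocks₂₂.PosDef := by
  have key : ∀ ν ν' : Nuis p q, ⟪act F.toBlocks₂₂ ν, ν'⟫ = ⟪act F (mkParam 0 ν), mkParam 0 ν'⟫ := by
    intro ν ν'
    rw [inner_param_nuis, nuis_act_eq]
    simp
  refine posDef_of_inner (isHermitian_of_inner fun u v => ?_) fun v hv => ?_
  · rw [key, key, hF.isHermitian.inner_act_comm, real_inner_comm]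
  · rw [key]
    exact hF.inner_act_pos fun h0 => hv (congrArg nuis h0)

/-- The Schur complement of the nuisance block. -/
def schur (F : Matrix (Idx p q) (Idx p q) ℝ) : Matrix (Fin p) (Fin p) ℝ :=
  F.toBlocks₁₁ - F.toBlocks₁₂ * (F.toBlocks₂₂)⁻¹ * F.toBlocks₂₁

/-- The vector with target component `a` whose image under `F` has no nuisance component. -/
def schurLift (F : Matrix (Idx p q) (Idx p q) ℝ) (a : EuclideanSpace ℝ (Fin p)) : Param p q :=
  mkParam a (-act (F.toBlocks₂₂)⁻¹ (act F.toBlocks₂₁ a))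

lemma act_schurLift (hF : F.PosDef) (a : EuclideanSpace ℝ (Fin p)) :
    act F (schurLift F a) = mkParam (act (schur F) a) 0 := by
  rw [← mkParam_target_nuis (act F _), target_act_eq, nuis_act_eq]
  congr 1
  · simp only [schurLift, schur, sub_act, mul_act, target_mkParam, nuis_mkParam, act_neg]
    abel
  · simp [schurLift, act_inv_act (posDef_toBlocks₂₂ hF).isUnit]

lemma inner_act_schur (hF : F.PosDef) (a a' : EuclideanSpace ℝ (Fin p)) :
    ⟪act (schur F) a, a'⟫ = ⟪act F (schurLift F a), schurLift F a'⟫ := by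
  rw [act_schurLift hF, inner_param_nuis]
  simp [schurLift]

lemma posDef_schur (hF : F.PosDef) : (schur F).PosDef := by
  refine posDef_of_inner (isHermitian_of_inner fun u v => ?_) fun v hv => ?_
  · rw [inner_act_schur hF, inner_act_schur hF, hF.isHermitian.inner_act_comm, real_inner_comm]
  · rw [inner_act_schur hF]
    exact hF.inner_act_pos fun h0 => hv (congrArg target h0)

/-- Block inversion for quadratic forms: the form of `F⁻¹` is the sum of the form of the inverse of
the nuisance block and the form of the Schur complement at the target component of `F⁻¹ s`. -/
lemma inner_inv_eq_add_schur (hF : F.PosDef) (s : Param p q) :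
    ⟪s, act F⁻¹ s⟫ = ⟪nuis s, act (F.toBlocks₂₂)⁻¹ (nuis s)⟫
      + ⟪act (schur F) (target (act F⁻¹ s)), target (act F⁻¹ s)⟫ := by
  set w := act F⁻¹ s with hw
  have hFw : act F w = s := act_inv_act hF.isUnit s
  have hU := (posDef_toBlocks₂₂ hF).isUnit
  set v : Param p q := mkParam 0 (act (F.toBlocks₂₂)⁻¹ (nuis s)) with hv
  have h1 : w - v = schurLift F (target w) := by
    rw [← mkParam_target_nuis (w - v), schurLift]
    congr 1
    · simp [hv]
    · have h2 := nuis_act_eq F w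
      rw [hFw] at h2
      rw [nuis_sub, hv, nuis_mkParam, h2, act_add, inv_act_act hU]
      abel
  have h2 : ⟪act F v, v⟫ = ⟪nuis s, act (F.toBlocks₂₂)⁻¹ (nuis s)⟫ := by
    rw [inner_param_nuis, nuis_act_eq]
    simp [hv, act_inv_act hU]
  have h3 : ⟪s, v⟫ = ⟪nuis s, act (F.toBlocks₂₂)⁻¹ (nuis s)⟫ := by
    rw [inner_param_nuis]
    simp [hv]
  have h4 : ⟪act F v, w⟫ = ⟪s, v⟫ := by
    rw [hF.isHermitian.inner_act_comm, hFw, real_inner_comm]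
  rw [inner_act_schur hF, ← h1, act_sub, hFw, inner_sub_left, inner_sub_right, inner_sub_right,
    h2, h4, h3]
  ring

end Schur

namespace Model

variable {Ω : Type*} [MeasurableSpace Ω] {M : Model p q Ω}
  {D : Matrix (Fin p) (Fin p) ℝ} {A₀ : Op p q}

/-- `‖(A - A₀) a‖ ≤ ‖(A - A₀) D⁻¹‖_Fr ‖D a‖`. -/
lemma near_of_mem_localSet (h : M.IsAdapted D A₀) {δ₀ : ℝ} (hδ : δ₀ ≤ 1 / 10) {υ : Param p q}
    (hυ : υ ∈ M.localSet D δ₀ A₀) : M.Near D A₀ (1 / 10) υ := by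
  obtain ⟨h1, h2, h3⟩ := hυ
  have hr : M.radius D δ₀ = δ₀ * M.scale D := by rw [radius, scale, mul_assoc]
  rw [hr] at h1 h2
  refine Near.mono h (ε₁ := δ₀) ⟨h1, h2, fun a => ?_⟩ hδ
  have h4 := norm_act_le_frobNorm (toMat (oper υ - A₀) * D⁻¹) (act D a)
  rw [mul_act, inv_act_act h.posDef.isUnit] at h4
  exact h4.trans (mul_le_mul_of_nonneg_right h3 (norm_nonneg _))

lemma inner_score (ω : Ω) (υ : Param p q) : ⟪M.score ω, υ⟫
    = ⟪M.noiseZ ω, image υ⟫ + M.μ * ⟪M.noiseU ω, oper υ⟫ := by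
  rw [inner_param, score, target_mkParam, image_mkParam, oper_mkParam, inner_zero_left,
    real_inner_smul_left, zero_add]

lemma LG_eq (ω : Ω) (υ : Param p q) : M.LG ω υ
    = M.lossG (∫ ω, M.Z ω ∂M.P) (∫ ω, M.Ahat ω ∂M.P) υ + ⟪M.score ω, υ⟫ + M.obsTerm ω := by
  rw [LG, L_eq, lossG, inner_score, noiseZ, noiseU, real_inner_smul_left, inner_sub_left,
    inner_sub_left, loss, loss]
  ring

lemma ELG_eq [IsProbabilityMeasure M.P] (hZ : MemLp M.Z 2 M.P) (hA : MemLp M.Ahat 2 M.P)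
    (υ : Param p q) : M.ELG υ
    = M.lossG (∫ ω, M.Z ω ∂M.P) (∫ ω, M.Ahat ω ∂M.P) υ + ∫ ω, M.obsTerm ω ∂M.P := by
  rw [ELG, EL_eq _ hZ hA, lossG]
  ring

lemma gradG_eq_zero_of_isMaxOn_ELG [IsProbabilityMeasure M.P] (hZ : MemLp M.Z 2 M.P)
    (hA : MemLp M.Ahat 2 M.P) {υ : Param p q} (hυ : IsMaxOn M.ELG Set.univ υ) (u : Param p q) :
    M.gradG (∫ ω, M.Z ω ∂M.P) (∫ ω, M.Ahat ω ∂M.P) υ u = 0 := by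
  have := M.gradG_add_inner_eq_zero_of_max (s := 0) (z := ∫ ω, M.Z ω ∂M.P)
    (a := ∫ ω, M.Ahat ω ∂M.P) (υ := υ) (fun υ' => ?_) u
  · simpa using this
  · have h1 : M.ELG υ' ≤ M.ELG υ := hυ (Set.mem_univ υ')
    rw [ELG_eq hZ hA, ELG_eq hZ hA] at h1
    simpa using h1

/-- The truth is a critical point of the penalized problem perturbed by the linear term
`⟨𝒢² υ*, ·⟩`. -/
lemma gradG_add_penMat_eq_zero_of_isMaxOn_EL [IsProbabilityMeasure M.P] (hZ : MemLp M.Z 2 M.P)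
    (hA : MemLp M.Ahat 2 M.P) {υ : Param p q} (hυ : IsMaxOn M.EL Set.univ υ) (u : Param p q) :
    M.gradG (∫ ω, M.Z ω ∂M.P) (∫ ω, M.Ahat ω ∂M.P) υ u + ⟪act M.penMat υ, u⟫ = 0 := by
  have h1 : IsLocalMax M.EL υ := (hυ.isLocalMax Filter.univ_mem)
  have h2 := h1.fderiv_eq_zero
  rw [show M.EL = fun υ => M.loss (∫ ω, M.Z ω ∂M.P) (∫ ω, M.Ahat ω ∂M.P) υ
    + ∫ ω, M.obsTerm ω ∂M.P from funext (M.EL_eq hZ hA), fderiv_add_const] at h2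
  rw [gradG, inner_penMat, ← fderiv_loss, h2]
  simp

lemma isMaxOn_LG_iff {ω : Ω} {υ : Param p q} : IsMaxOn (M.LG ω) Set.univ υ ↔
    ∀ υ', M.lossG (∫ ω, M.Z ω ∂M.P) (∫ ω, M.Ahat ω ∂M.P) υ' + ⟪M.score ω, υ'⟫
      ≤ M.lossG (∫ ω, M.Z ω ∂M.P) (∫ ω, M.Ahat ω ∂M.P) υ + ⟪M.score ω, υ⟫ := by
  simp [isMaxOn_iff, LG_eq]

lemma stdStoch_eq (D : Matrix (Fin p) (Fin p) ℝ) (υ : Param p q) (ω : Ω) :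
    M.stdStoch D υ ω = act (M.metric D) (M.stoch υ ω) := mul_act _ _ _

lemma bias_eq (υ υs : Param p q) :
    M.bias υ υs = act (M.infoG υ)⁻¹ (act M.penMat υs) := mul_act _ _ _

lemma norm_act_target_le (hD : D.PosDef) {m : ℕ} (Q : Matrix (Fin m) (Fin p) ℝ) (δ : Param p q) :
    ‖act Q (target δ)‖ ≤ opNorm (Q * D⁻¹) * ‖act (M.metric D) δ‖ := by
  have h1 : act Q (target δ) = act (Q * D⁻¹) (act D (target δ)) := by
    rw [mul_act, inv_act_act hD.isUnit]
  rw [h1]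
  exact (norm_act_le _ _).trans (mul_le_mul_of_nonneg_left
    (IsAdapted.norm_target_le (M := M) δ) (opNorm_nonneg _))

lemma tau3_eq (D : Matrix (Fin p) (Fin p) ℝ) : M.tau3 D = 9 / 2 / M.scale D := by
  rw [tau3, scale, mul_comm]

/-- The target component of `critical_expansion`. -/
lemma norm_act_critical_le [IsProbabilityMeasure M.P] (hZ : MemLp M.Z 2 M.P)
    (hA : MemLp M.Ahat 2 M.P) (h : M.IsAdapted D A₀) {υ υ₁ : Param p q}
    (hυ : M.Near D A₀ (1 / 10) υ) (hυ₁ : M.Near D A₀ (1 / 10) υ₁)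
    {z : EuclideanSpace ℝ (Fin q)} {a : Op p q}
    (h0 : ∀ u, M.gradG z a υ u = 0) {s : Param p q}
    (h1 : ∀ u, M.gradG z a υ₁ u + ⟪s, u⟫ = 0)
    (hs : 81 * ‖act (M.metric D) (act (M.infoG υ)⁻¹ s)‖ < 2 * M.scale D)
    {m : ℕ} (Q : Matrix (Fin m) (Fin p) ℝ) :
    ‖act Q (target (υ₁ - υ - act (M.infoG υ)⁻¹ s))‖
      ≤ opNorm (Q * D⁻¹) * (3 * M.tau3 D)
        * ‖act (M.metric D) (act (M.infoG υ)⁻¹ s)‖ ^ 2 := by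
  have hS := h.scale_pos
  refine (norm_act_target_le (M := M) h.posDef Q _).trans ?_
  rw [mul_assoc]
  refine mul_le_mul_of_nonneg_left ?_ (opNorm_nonneg _)
  have h2 := (critical_expansion hZ hA h hυ hυ₁ h0 h1 hs).2
  rw [tau3_eq, show 3 * (9 / 2 / M.scale D)
    * ‖act (M.metric D) (act (M.infoG υ)⁻¹ s)‖ ^ 2
    = 27 / 2 * ‖act (M.metric D) (act (M.infoG υ)⁻¹ s)‖ ^ 2 / M.scale D by ring,
    le_div_iff₀ hS]
  linarith

/-- The bound for the stochastic term. With `u = 𝔽_𝒢⁻¹ ∇ζ` it compares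
`⟨∇ζ, u⟩ = ⟨𝔽_𝒢 u, u⟩ ≥ (‖𝒟 u‖² + 4 ‖𝒦 u_A‖²) / 4` with the upper bound for `⟨∇ζ, u⟩` given by the
Cauchy-Schwarz inequality. -/
lemma norm_stdStoch_sq_le [IsProbabilityMeasure M.P] (hZ : MemLp M.Z 2 M.P)
    (hA : MemLp M.Ahat 2 M.P) (h : M.IsAdapted D A₀) {υ : Param p q}
    (hυ : M.Near D A₀ (1 / 10) υ) (ω : Ω) :
    ‖M.stdStoch D υ ω‖ ^ 2 ≤ 2 ^ 4 * ‖M.noiseZ ω‖ ^ 2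
      + 2 ^ 4 * ‖act (matSqrt (1 + ((2 : ℝ) ^ 2 / M.μ ^ 2) • (M.K.transpose * M.K)))⁻¹
        (M.noiseU ω)‖ ^ 2 := by
  have hμ := h.mu_pos
  rw [stdStoch_eq]
  set u := M.stoch υ ω
  have h1 : M.hessG υ u u = ⟪M.score ω, u⟫ := hessG_inv_infoG hZ hA h hυ _ _
  have h2 := hυ.quarter_le_hessG h u
  rw [h1, inner_score, norm_act_metric_sq] at h2
  set T := 1 + ((2 : ℝ) ^ 2 / M.μ ^ 2) • (M.K.transpose * M.K) with hT_def
  have hKK : (M.K.transpose * M.K).PosSemidef := by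
    rw [← Matrix.conjTranspose_eq_transpose_of_trivial]
    exact Matrix.posSemidef_conjTranspose_mul_self _
  have hT : T.PosDef := Matrix.PosDef.one.add_posSemidef (hKK.smul (by positivity))
  have hV := isUnit_matSqrt hT
  have hTn : ‖act (matSqrt T) (oper u)‖ ^ 2
      = ‖oper u‖ ^ 2 + 2 ^ 2 / M.μ ^ 2 * ‖act M.K (oper u)‖ ^ 2 := by
    rw [norm_act_matSqrt_sq hT.posSemidef, hT_def, add_act, smul_act, one_act, inner_add_left,
      real_inner_smul_left, inner_transpose_mul_act, real_inner_self_eq_norm_sq,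
      real_inner_self_eq_norm_sq]
  have h3 : ⟪M.noiseU ω, oper u⟫
      ≤ ‖act (matSqrt T)⁻¹ (M.noiseU ω)‖ * ‖act (matSqrt T) (oper u)‖ := by
    have h4 : ⟪M.noiseU ω, oper u⟫
        = ⟪act (matSqrt T)⁻¹ (M.noiseU ω), act (matSqrt T) (oper u)⟫ := by
      rw [← (isHermitian_matSqrt T).inner_act_comm, act_inv_act hV]
    rw [h4]
    exact real_inner_le_norm _ _
  have h4 := real_inner_le_norm (M.noiseZ ω) (image u)
  have h5 : (M.μ * ‖act (matSqrt T) (oper u)‖) ^ 2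
      = (M.μ * ‖oper u‖) ^ 2 + 4 * ‖act M.K (oper u)‖ ^ 2 := by
    rw [mul_pow, hTn]
    field_simp
    ring
  have h6 := mul_le_mul_of_nonneg_left h3 hμ.le
  rw [norm_act_metric_sq]
  set c := M.μ * ‖act (matSqrt T) (oper u)‖ with hc
  set V := ‖act (matSqrt T)⁻¹ (M.noiseU ω)‖
  have h7 : M.μ * (V * ‖act (matSqrt T) (oper u)‖) = V * c := by rw [hc]; ring
  nlinarith [sq_nonneg (‖image u‖ - 4 * ‖M.noiseZ ω‖), sq_nonneg (c - 4 * V),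
    sq_nonneg ‖act D (target u)‖, sq_nonneg ‖act M.K (oper u)‖, sq_nonneg (‖image u‖),
    sq_nonneg c]

lemma ciSup_eq_of_forall_le {ι : Type*} {f : ι → ℝ} {i : ι} (hi : ∀ j, f j ≤ f i) :
    ⨆ j, f j = f i := by
  have : Nonempty ι := ⟨i⟩
  exact le_antisymm (ciSup_le hi) (le_ciSup ⟨f i, by rintro _ ⟨j, rfl⟩; exact hi j⟩ i)

lemma profile_target_of_isMaxOn {ω : Ω} {υ : Param p q} (hυ : IsMaxOn (M.LG ω) Set.univ υ) :
    M.profile ω (target υ) = M.LG ω υ := by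
  have h1 : M.LG ω (mkParam (target υ) (nuis υ)) = M.LG ω υ := by rw [mkParam_target_nuis]
  rw [← h1]
  refine ciSup_eq_of_forall_le (i := nuis υ) fun ν => ?_
  rw [h1]
  exact hυ (Set.mem_univ _)

/-- For a fixed target the objective is a quadratic function of the nuisance, so its maximum at the
target of a critical point of the expected objective is explicit. -/
lemma profile_target_eq [IsProbabilityMeasure M.P] (hZ : MemLp M.Z 2 M.P)
    (hA : MemLp M.Ahat 2 M.P) {υ : Param p q} (hF : (M.infoG υ).PosDef)
    (h0 : ∀ u, M.gradG (∫ ω, M.Z ω ∂M.P) (∫ ω, M.Ahat ω ∂M.P) υ u = 0) (ω : Ω) :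
    2 * M.profile ω (target υ) = 2 * M.LG ω υ
      + ⟪nuis (M.score ω), act ((M.infoG υ).toBlocks₂₂)⁻¹ (nuis (M.score ω))⟫ := by
  set B := (M.infoG υ).toBlocks₂₂
  have hB : B.PosDef := posDef_toBlocks₂₂ hF
  set σ := nuis (M.score ω)
  have hval : ∀ d : Nuis p q, 2 * M.LG ω (mkParam (target υ) (nuis υ + d))
      = 2 * M.LG ω υ + 2 * ⟪σ, d⟫ - ⟪act B d, d⟫ := fun d => by
    have h1 : mkParam (target υ) (nuis υ + d) = υ + mkParam 0 d := by
      conv_rhs => rw [← mkParam_target_nuis υ]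
      rw [← mkParam_add, add_zero]
    have h2 : quad (mkParam 0 d : Param p q) = 0 := act_zero _
    have h3 : tri (υ + (1 / 4 : ℝ) • mkParam 0 d) (mkParam 0 d) (mkParam 0 d) = 0 := by
      rw [tri, quad₂_self, h2]
      simp
    have h4 : M.hessG υ (mkParam 0 d) (mkParam 0 d) = ⟪act B d, d⟫ := by
      rw [← inner_infoG hZ hA, inner_param_nuis, nuis_act_eq]
      simp [B]
    have h5 : ⟪M.score ω, (mkParam 0 d : Param p q)⟫ = ⟪σ, d⟫ := by
      rw [inner_param_nuis]
      simp [σ]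
    rw [h1, LG_eq, LG_eq, lossG_add, h0, h3, h4, inner_add_right, h5]
    ring
  set e := act B⁻¹ σ
  have hBe : act B e = σ := act_inv_act hB.isUnit σ
  have hmax : M.profile ω (target υ) = M.LG ω (mkParam (target υ) (nuis υ + e)) := by
    refine ciSup_eq_of_forall_le (i := nuis υ + e) fun ν => ?_
    obtain ⟨d, rfl⟩ : ∃ d, ν = nuis υ + d := ⟨ν - nuis υ, (add_sub_cancel _ _).symm⟩
    have h1 := hval d
    have h2 := hval e
    have h3 := (posSemidef_iff_inner.1 hB.posSemidef).2 (d - e)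
    rw [act_sub, hBe, inner_sub_left, inner_sub_right, inner_sub_right,
      hB.isHermitian.inner_act_comm d e, hBe, real_inner_comm σ d] at h3
    rw [hBe] at h2
    linarith
  rw [hmax, hval, hBe]
  ring

/-- The expansion of the profile log-likelihood. -/
lemma abs_profile_sub_le [IsProbabilityMeasure M.P] (hZ : MemLp M.Z 2 M.P)
    (hA : MemLp M.Ahat 2 M.P) (h : M.IsAdapted D A₀) {υ υ₁ : Param p q}
    (hυ : M.Near D A₀ (1 / 10) υ) (hυ₁ : M.Near D A₀ (1 / 10) υ₁)
    (h0 : ∀ u, M.gradG (∫ ω, M.Z ω ∂M.P) (∫ ω, M.Ahat ω ∂M.P) υ u = 0) {ω : Ω}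
    (h1 : IsMaxOn (M.LG ω) Set.univ υ₁)
    (hs : 81 * ‖M.stdStoch D υ ω‖ < 2 * M.scale D) :
    |2 * M.profile ω (target υ₁) - 2 * M.profile ω (target υ) - ‖M.semiScore υ ω‖ ^ 2|
      ≤ M.tau3 D / 2 * ‖M.stdStoch D υ ω‖ ^ 3 := by
  have hF := hυ.posDef_infoG hZ hA h
  have hS := h.scale_pos
  rw [stdStoch_eq] at hs ⊢
  have h2 := maximum_expansion hZ hA h hυ hυ₁ h0 (isMaxOn_LG_iff.1 h1) hs
  have h3 : ‖M.semiScore υ ω‖ ^ 2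
      = ⟪act (schur (M.infoG υ)) (target (M.stoch υ ω)), target (M.stoch υ ω)⟫ :=
    norm_act_matSqrt_sq (posDef_schur hF).posSemidef _
  have h4 : 2 * M.profile ω (target υ₁) - 2 * M.profile ω (target υ) - ‖M.semiScore υ ω‖ ^ 2
      = 2 * (M.lossG (∫ ω, M.Z ω ∂M.P) (∫ ω, M.Ahat ω ∂M.P) υ₁ + ⟪M.score ω, υ₁⟫)
        - 2 * (M.lossG (∫ ω, M.Z ω ∂M.P) (∫ ω, M.Ahat ω ∂M.P) υ + ⟪M.score ω, υ⟫)
        - ⟪M.score ω, act (M.infoG υ)⁻¹ (M.score ω)⟫ := by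
    rw [profile_target_of_isMaxOn h1, profile_target_eq hZ hA hF h0,
      inner_inv_eq_add_schur hF (M.score ω), h3, LG_eq, LG_eq, stoch]
    ring
  rw [h4, tau3_eq, show 9 / 2 / M.scale D / 2 * ‖act (M.metric D) (M.stoch υ ω)‖ ^ 3
    = 9 / 4 * ‖act (M.metric D) (M.stoch υ ω)‖ ^ 3 / M.scale D by ring, le_div_iff₀ hS, mul_comm]
  exact h2

end Model

end ErrInOp

/-! ### Covariance matrices and Minkowski's inequality -/

namespace ErrInOp

open scoped RealInnerProductSpace

section Covariance

variable {Ω : Type*} [MeasurableSpace Ω] {P : Measure Ω} {n : Type*} [Fintype n]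
  {X : Ω → EuclideanSpace ℝ n}

lemma covMat_apply_of_integral_eq_zero [IsFiniteMeasure P] (hX : MemLp X 2 P)
    (h0 : ∫ ω, X ω ∂P = 0) (i j : n) : covMat P X i j = ∫ ω, X ω i * X ω j ∂P := by
  have h1 : ∀ i, ∫ ω, X ω i ∂P = 0 := fun i => by
    rw [← eval_integral_piLp (hX.integrable one_le_two).eval_piLp, h0]
    rfl
  simp only [covMat, Matrix.of_apply, covariance, h1, sub_zero]

lemma trace_covMat [IsFiniteMeasure P] (hX : MemLp X 2 P) (h0 : ∫ ω, X ω ∂P = 0) :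
    (covMat P X).trace = ∫ ω, ‖X ω‖ ^ 2 ∂P := by
  simp only [norm_sq_eq_sum, Matrix.trace, Matrix.diag, covMat_apply_of_integral_eq_zero hX h0,
    ← sq]
  exact (integral_finsetSum _ fun i _ => (hX.eval_piLp i).integrable_sq).symm

lemma posSemidef_covMat [DecidableEq n] [IsFiniteMeasure P] (hX : MemLp X 2 P)
    (h0 : ∫ ω, X ω ∂P = 0) : (covMat P X).PosSemidef := by
  have hint : ∀ i j, Integrable (fun ω => X ω i * X ω j) P := fun i j =>
    (hX.eval_piLp i).integrable_mul (hX.eval_piLp j)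
  refine posSemidef_iff_inner.2 ⟨?_, fun v => ?_⟩
  · ext i j
    simp only [Matrix.conjTranspose_apply, covMat_apply_of_integral_eq_zero hX h0, star_trivial,
      mul_comm]
  · have hsq : ∀ ω, (∑ i, v i * X ω i) ^ 2 = ∑ i, ∑ j, v i * v j * (X ω i * X ω j) := fun ω => by
      rw [sq, Finset.sum_mul_sum]
      exact Finset.sum_congr rfl fun i _ => Finset.sum_congr rfl fun j _ => by ring
    have hint' : ∀ i j, Integrable (fun ω => v i * v j * (X ω i * X ω j)) P := fun i j =>
      (hint i j).const_mul _
    have : ⟪act (covMat P X) v, v⟫ = ∫ ω, (∑ i, v i * X ω i) ^ 2 ∂P := by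
      simp only [hsq]
      rw [integral_finsetSum _ fun i _ => integrable_finsetSum _ fun j _ => hint' i j]
      simp only [inner_eq_sum, act_apply, covMat_apply_of_integral_eq_zero hX h0, Finset.sum_mul]
      refine Finset.sum_congr rfl fun i _ => ?_
      rw [integral_finsetSum _ fun j _ => hint' i j]
      refine Finset.sum_congr rfl fun j _ => ?_
      rw [integral_const_mul]
      ring
    rw [this]
    exact integral_nonneg fun ω => sq_nonneg _

variable {m : Type*} [Fintype m] [DecidableEq n]

lemma memLp_act (T : Matrix m n ℝ) (hX : MemLp X 2 P) : MemLp (fun ω => act T (X ω)) 2 P :=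
  (LinearMap.toContinuousLinearMap (Matrix.toEuclideanLin T)).comp_memLp' hX

lemma integral_act_eq_zero [IsFiniteMeasure P] (T : Matrix m n ℝ) (hX : MemLp X 2 P)
    (h0 : ∫ ω, X ω ∂P = 0) : ∫ ω, act T (X ω) ∂P = 0 := by
  have := (LinearMap.toContinuousLinearMap (Matrix.toEuclideanLin T)).integral_comp_comm
    (hX.integrable one_le_two)
  rw [h0, map_zero] at this
  exact this

end Covariance

section Minkowski

variable {Ω : Type*} [MeasurableSpace Ω] {P : Measure Ω} {f g : Ω → ℝ}

lemma integral_mul_le_sqrt_mul_sqrt (hf : MemLp f 2 P) (hg : MemLp g 2 P) :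
    ∫ ω, f ω * g ω ∂P ≤ √(∫ ω, f ω ^ 2 ∂P) * √(∫ ω, g ω ^ 2 ∂P) := by
  have hf0 : 0 ≤ ∫ ω, f ω ^ 2 ∂P := integral_nonneg fun _ => sq_nonneg _
  have hfg : Integrable (fun ω => f ω * g ω) P := hf.integrable_mul hg
  have h1 : ∀ t : ℝ, 0 ≤ (∫ ω, f ω ^ 2 ∂P) * (t * t) + (2 * ∫ ω, f ω * g ω ∂P) * t
      + ∫ ω, g ω ^ 2 ∂P := fun t => by
    have h2 : ∫ ω, (t * f ω + g ω) ^ 2 ∂P = (∫ ω, f ω ^ 2 ∂P) * (t * t)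
        + (2 * ∫ ω, f ω * g ω ∂P) * t + ∫ ω, g ω ^ 2 ∂P := by
      have h3 : ∀ ω, (t * f ω + g ω) ^ 2
          = t * t * f ω ^ 2 + 2 * t * (f ω * g ω) + g ω ^ 2 := fun ω => by ring
      have i1 : Integrable (fun ω => t * t * f ω ^ 2) P := hf.integrable_sq.const_mul _
      have i2 : Integrable (fun ω => 2 * t * (f ω * g ω)) P := hfg.const_mul _
      have i12 : Integrable (fun ω => t * t * f ω ^ 2 + 2 * t * (f ω * g ω)) P := i1.add i2
      simp only [h3]
      rw [integral_add i12 hg.integrable_sq, integral_add i1 i2, integral_const_mul,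
        integral_const_mul]
      ring
    rw [← h2]
    exact integral_nonneg fun _ => sq_nonneg _
  have h4 := discrim_le_zero h1
  rw [discrim] at h4
  rw [← Real.sqrt_mul hf0]
  exact Real.le_sqrt_of_sq_le (by linarith)

lemma sqrt_integral_sq_le_add {e : Ω → ℝ} (hf : MemLp f 2 P) (hg : MemLp g 2 P) (he : MemLp e 2 P)
    (h0 : ∀ᵐ ω ∂P, 0 ≤ f ω) (h : ∀ᵐ ω ∂P, f ω ≤ g ω + e ω) :
    √(∫ ω, f ω ^ 2 ∂P) ≤ √(∫ ω, g ω ^ 2 ∂P) + √(∫ ω, e ω ^ 2 ∂P) := by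
  have hge : Integrable (fun ω => g ω * e ω) P := hg.integrable_mul he
  have hg0 : 0 ≤ ∫ ω, g ω ^ 2 ∂P := integral_nonneg fun _ => sq_nonneg _
  have he0 : 0 ≤ ∫ ω, e ω ^ 2 ∂P := integral_nonneg fun _ => sq_nonneg _
  refine Real.sqrt_le_iff.2 ⟨by positivity, ?_⟩
  have i1 : Integrable (fun ω => g ω ^ 2 + 2 * (g ω * e ω)) P :=
    hg.integrable_sq.add (hge.const_mul _)
  have h1 : ∫ ω, f ω ^ 2 ∂P ≤ ∫ ω, (g ω ^ 2 + 2 * (g ω * e ω)) + e ω ^ 2 ∂P := by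
    refine integral_mono_ae hf.integrable_sq (i1.add he.integrable_sq :) ?_
    filter_upwards [h0, h] with ω h2 h3
    have := pow_le_pow_left₀ h2 h3 2
    linarith
  rw [integral_add i1 he.integrable_sq, integral_add hg.integrable_sq (hge.const_mul _),
    integral_const_mul] at h1
  have h2 := integral_mul_le_sqrt_mul_sqrt hg he
  rw [add_sq, Real.sq_sqrt hg0, Real.sq_sqrt he0]
  linarith

lemma integral_le_sqrt_integral_sq [IsFiniteMeasure P] (hP : P.real Set.univ ≤ 1)
    (hf : MemLp f 2 P) : ∫ ω, f ω ∂P ≤ √(∫ ω, f ω ^ 2 ∂P) := by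
  have h1 := integral_mul_le_sqrt_mul_sqrt hf (memLp_const (μ := P) (p := 2) (1 : ℝ))
  simp only [mul_one, one_pow, integral_const, smul_eq_mul] at h1
  refine h1.trans (mul_le_of_le_one_right (Real.sqrt_nonneg _) ?_)
  exact Real.sqrt_le_one.2 hP

end Minkowski

namespace Model

variable {p q : ℕ} {Ω : Type*} [MeasurableSpace Ω] {M : Model p q Ω} [IsProbabilityMeasure M.P]

lemma memLp_score (hZ : MemLp M.Z 2 M.P) (hA : MemLp M.Ahat 2 M.P) : MemLp M.score 2 M.P := by
  have h1 : MemLp M.noiseZ 2 M.P := hZ.sub (memLp_const _)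
  have h2 : MemLp (fun ω => M.μ • M.noiseU ω) 2 M.P :=
    ((hA.sub (memLp_const _)).const_smul M.μ).const_smul M.μ
  refine MemLp.of_eval_piLp fun i => ?_
  rcases i with i | i | i
  · exact MemLp.zero
  · exact h1.eval_piLp i
  · exact h2.eval_piLp i

lemma integral_score (hZ : MemLp M.Z 2 M.P) (hA : MemLp M.Ahat 2 M.P) :
    ∫ ω, M.score ω ∂M.P = 0 := by
  have h1 : MemLp M.noiseZ 2 M.P := hZ.sub (memLp_const _)
  have h2 : MemLp (fun ω => M.μ • M.noiseU ω) 2 M.P :=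
    ((hA.sub (memLp_const _)).const_smul M.μ).const_smul M.μ
  have h3 : ∫ ω, M.noiseZ ω ∂M.P = 0 := by
    simp only [noiseZ]
    rw [integral_sub (hZ.integrable one_le_two) (integrable_const _)]
    simp
  have h4 : ∫ ω, M.μ • M.noiseU ω ∂M.P = 0 := by
    simp only [noiseU, integral_smul]
    rw [integral_sub (hA.integrable one_le_two) (integrable_const _)]
    simp
  ext i
  rw [eval_integral_piLp ((memLp_score hZ hA).integrable one_le_two).eval_piLp]
  rcases i with i | i | i
  · exact integral_zero _ _
  · have := eval_integral_piLp (h1.integrable one_le_two).eval_piLp i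
    rw [h3] at this
    exact this.symm
  · have := eval_integral_piLp (h2.integrable one_le_two).eval_piLp i
    rw [h4] at this
    exact this.symm

end Model

end ErrInOp

/-! ### Risk bounds -/

namespace ErrInOp

section Risk

variable {Ω : Type*} [MeasurableSpace Ω] {P : Measure Ω} [IsFiniteMeasure P] {E : Type*}
  [NormedAddCommGroup E] {X Y : Ω → E} {r : Ω → ℝ} {c b v : ℝ}

/-- The expected norm of a random vector `X` that is close to `Y`, up to a random remainder `r` and
a constant one. -/
lemma integral_norm_le_of_close (hP : P.real Set.univ ≤ 1) (hX : MemLp X 2 P) (hY : MemLp Y 2 P)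
    (hr : MemLp r 2 P) (hc : 0 ≤ c) (hb : 0 ≤ b)
    (hXY : ∀ᵐ ω ∂P, ‖X ω - Y ω‖ ≤ c * (r ω + b)) (hv : ∫ ω, r ω ∂P ≤ v) :
    ∫ ω, ‖X ω‖ ∂P ≤ √(∫ ω, ‖Y ω‖ ^ 2 ∂P) + c * (v + b) := by
  have i1 : Integrable (fun ω => ‖Y ω‖) P := hY.norm.integrable one_le_two
  have i2 : Integrable (fun ω => r ω + b) P := (hr.integrable one_le_two).add (integrable_const _)
  have h1 : ∫ ω, ‖X ω‖ ∂P ≤ ∫ ω, ‖Y ω‖ + c * (r ω + b) ∂P := by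
    refine integral_mono_ae (hX.norm.integrable one_le_two) (i1.add (i2.const_mul c) :) ?_
    filter_upwards [hXY] with ω h
    have h2 := norm_add_le (Y ω) (X ω - Y ω)
    rw [add_sub_cancel] at h2
    linarith
  rw [integral_add i1 (i2.const_mul c), integral_const_mul,
    integral_add (hr.integrable one_le_two) (integrable_const _)] at h1
  have h2 := integral_le_sqrt_integral_sq hP hY.norm
  have h3 : ∫ _, b ∂P ≤ b := by
    rw [integral_const, smul_eq_mul]
    exact mul_le_of_le_one_left hb hP
  have h4 : c * (∫ ω, r ω ∂P + ∫ _, b ∂P) ≤ c * (v + b) :=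
    mul_le_mul_of_nonneg_left (by linarith) hc
  linarith

/-- The root mean square of a random vector `X` that is close to `Y`, up to a random remainder `r`
and a constant one. -/
lemma abs_sqrt_sub_sqrt_le_of_close (hP : P.real Set.univ ≤ 1) (hX : MemLp X 2 P)
    (hY : MemLp Y 2 P) (hr : MemLp r 2 P) (hc : 0 ≤ c) (hb : 0 ≤ b)
    (hXY : ∀ᵐ ω ∂P, ‖X ω - Y ω‖ ≤ c * (r ω + b)) (hv0 : 0 ≤ v)
    (hv : ∫ ω, r ω ^ 2 ∂P ≤ v ^ 2) :
    |√(∫ ω, ‖X ω‖ ^ 2 ∂P) - √(∫ ω, ‖Y ω‖ ^ 2 ∂P)| ≤ c * (v + b) := by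
  have he : MemLp (fun ω => c * (r ω + b)) 2 P := (hr.add (memLp_const b)).const_mul c
  have h1 : √(∫ ω, (c * (r ω + b)) ^ 2 ∂P) ≤ c * (v + b) := by
    have hr1 : ∫ ω, r ω ∂P ≤ v := (integral_le_sqrt_integral_sq hP hr).trans
      (Real.sqrt_le_iff.2 ⟨hv0, hv⟩)
    have h2 : ∀ ω, (c * (r ω + b)) ^ 2
        = c ^ 2 * r ω ^ 2 + c ^ 2 * (2 * b) * r ω + c ^ 2 * b ^ 2 := fun ω => by ring
    have i1 : Integrable (fun ω => c ^ 2 * r ω ^ 2) P := hr.integrable_sq.const_mul _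
    have i2 : Integrable (fun ω => c ^ 2 * (2 * b) * r ω) P :=
      (hr.integrable one_le_two).const_mul _
    have i12 : Integrable (fun ω => c ^ 2 * r ω ^ 2 + c ^ 2 * (2 * b) * r ω) P := i1.add i2
    refine Real.sqrt_le_iff.2 ⟨by positivity, ?_⟩
    simp only [h2]
    rw [integral_add i12 (integrable_const _), integral_add i1 i2, integral_const_mul,
      integral_const_mul, integral_const, smul_eq_mul]
    have h3 : c ^ 2 * ∫ ω, r ω ^ 2 ∂P ≤ c ^ 2 * v ^ 2 :=
      mul_le_mul_of_nonneg_left hv (by positivity)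
    have h4 : c ^ 2 * (2 * b) * ∫ ω, r ω ∂P ≤ c ^ 2 * (2 * b) * v :=
      mul_le_mul_of_nonneg_left hr1 (by positivity)
    have h5 : P.real Set.univ * (c ^ 2 * b ^ 2) ≤ c ^ 2 * b ^ 2 :=
      mul_le_of_le_one_left (by positivity) hP
    linarith
  have h2 := sqrt_integral_sq_le_add hX.norm hY.norm he
    (Filter.Eventually.of_forall fun _ => norm_nonneg _) (by
      filter_upwards [hXY] with ω h
      have h2 := norm_add_le (Y ω) (X ω - Y ω)
      rw [add_sub_cancel] at h2
      linarith)
  have h3 := sqrt_integral_sq_le_add hY.norm hX.norm he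
    (Filter.Eventually.of_forall fun _ => norm_nonneg _) (by
      filter_upwards [hXY] with ω h
      have h2 := norm_sub_le (X ω) (X ω - Y ω)
      rw [sub_sub_cancel] at h2
      linarith)
  rw [abs_le]
  constructor <;> linarith

end Risk

namespace Model

open scoped RealInnerProductSpace

variable {p q : ℕ} {Ω : Type*} [MeasurableSpace Ω] {M : Model p q Ω} [IsProbabilityMeasure M.P]

lemma memLp_stdStoch (hZ : MemLp M.Z 2 M.P) (hA : MemLp M.Ahat 2 M.P)
    (D : Matrix (Fin p) (Fin p) ℝ) (υ : Param p q) : MemLp (M.stdStoch D υ) 2 M.P :=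
  memLp_act _ (memLp_score hZ hA)

lemma integral_stdStoch (hZ : MemLp M.Z 2 M.P) (hA : MemLp M.Ahat 2 M.P)
    (D : Matrix (Fin p) (Fin p) ℝ) (υ : Param p q) : ∫ ω, M.stdStoch D υ ω ∂M.P = 0 :=
  integral_act_eq_zero _ (memLp_score hZ hA) (integral_score hZ hA)

lemma nullMeasurableSet_goodSet (hZ : MemLp M.Z 2 M.P) (hA : MemLp M.Ahat 2 M.P)
    (D : Matrix (Fin p) (Fin p) ℝ) (υ : Param p q) (x : ℝ) :
    NullMeasurableSet (M.goodSet D υ x) M.P :=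
  nullMeasurableSet_le (memLp_stdStoch hZ hA D υ).1.norm.aemeasurable aemeasurable_const

lemma one_sub_le_goodSet (hZ : MemLp M.Z 2 M.P) (hA : MemLp M.Ahat 2 M.P)
    (D : Matrix (Fin p) (Fin p) ℝ) (υ : Param p q) (x : ℝ)
    (hdev : DeviationCondition M.P (M.metric D * (M.infoG υ)⁻¹) M.score x) :
    1 - 3 * Real.exp (-x) ≤ M.P.real (M.goodSet D υ x) := by
  have h1 := probReal_compl_eq_one_sub₀ (nullMeasurableSet_goodSet hZ hA D υ x)
  have h2 : (M.goodSet D υ x)ᶜ = {ω | zFun (covMat M.P fun ω' =>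
      act (M.metric D * (M.infoG υ)⁻¹) (M.score ω')) x
      < ‖act (M.metric D * (M.infoG υ)⁻¹) (M.score ω)‖} := by
    ext ω
    exact not_le (a := ‖M.stdStoch D υ ω‖) (b := M.rD D υ x)
  rw [h2] at h1
  have h3 : M.P.real _ ≤ 3 * Real.exp (-x) := hdev
  linarith

/-- The linear images of the target component of `𝔽_𝒢⁻¹ ∇ζ` are square integrable and
centered. -/
lemma memLp_act_target_stoch (hZ : MemLp M.Z 2 M.P) (hA : MemLp M.Ahat 2 M.P) (υ : Param p q)
    {m : ℕ} (Q : Matrix (Fin m) (Fin p) ℝ) :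
    MemLp (fun ω => act Q (target (M.stoch υ ω))) 2 M.P ∧
      ∫ ω, act Q (target (M.stoch υ ω)) ∂M.P = 0 := by
  -- the target component is the linear map with matrix `[I 0]`
  set T : Matrix (Fin p) (Idx p q) ℝ :=
    Matrix.of fun i => Sum.elim (fun j => (1 : Matrix _ _ ℝ) i j) (fun _ => 0) with hT
  have h1 : ∀ υ' : Param p q, target υ' = act T υ' := fun υ' => by
    ext i
    simp [hT, target, act_apply, Fintype.sum_sum_type, Matrix.one_apply]
  have h2 : (fun ω => act Q (target (M.stoch υ ω)))
      = fun ω => act (Q * T * (M.infoG υ)⁻¹) (M.score ω) := by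
    ext1 ω
    rw [h1, stoch, mul_act, mul_act]
  rw [h2]
  exact ⟨memLp_act _ (memLp_score hZ hA),
    integral_act_eq_zero _ (memLp_score hZ hA) (integral_score hZ hA)⟩

lemma riskQ_le (hZ : MemLp M.Z 2 M.P) (hA : MemLp M.Ahat 2 M.P) (D : Matrix (Fin p) (Fin p) ℝ)
    (υG υs : Param p q) (x : ℝ) {m : ℕ} (Q : Matrix (Fin m) (Fin p) ℝ) :
    M.riskQ D υG υs x Q ≤ (covMat M.P fun ω => act Q (target (M.stoch υG ω))).trace
      + ‖act Q (target (M.bias υG υs))‖ ^ 2 := by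
  obtain ⟨h1, h2⟩ := memLp_act_target_stoch hZ hA υG Q
  set V := fun ω => act Q (target (M.stoch υG ω))
  set β := act Q (target (M.bias υG υs))
  have h3 : M.riskQ D υG υs x Q ≤ ∫ ω, ‖V ω - β‖ ^ 2 ∂M.P :=
    setIntegral_le_integral (h1.sub (memLp_const β)).norm.integrable_sq
      (Filter.Eventually.of_forall fun ω => sq_nonneg _)
  refine h3.trans (le_of_eq ?_)
  have i1 : Integrable (fun ω => ‖V ω‖ ^ 2) M.P := h1.norm.integrable_sq
  have i2 : Integrable (fun ω => 2 * ⟪β, V ω⟫) M.P :=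
    ((h1.integrable one_le_two).const_inner β).const_mul 2
  have i12 : Integrable (fun ω => ‖V ω‖ ^ 2 - 2 * ⟪β, V ω⟫) M.P := i1.sub i2
  simp only [norm_sub_sq_real, real_inner_comm β]
  rw [integral_add i12 (integrable_const _), integral_sub i1 i2, integral_const_mul,
    integral_inner (h1.integrable one_le_two), h2, trace_covMat h1 h2]
  simp

end Model

end ErrInOp

end

open ErrInOp ErrInOp.Model

theorem mainTheorem1 {p q : ℕ} (hp : 0 < p) {Ω : Type*} [MeasurableSpace Ω]
    (M : ErrInOp.Model p q Ω) [MeasureTheory.IsProbabilityMeasure M.P] (hμ : 0 < M.μ)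
    (hZ : MeasureTheory.MemLp M.Z 2 M.P) (hA : MeasureTheory.MemLp M.Ahat 2 M.P)
    (D : Matrix (Fin p) (Fin p) ℝ) (hD : D.PosDef) (δ₀ : ℝ) (hδ : δ₀ ≤ 1 / 10)
    (x : ℝ) (hx : 0 < x)
    -- the truth, its penalized counterpart, and the penalized MLE
    (υs υG : ErrInOp.Param p q) (υt : Ω → ErrInOp.Param p q) (hυt : Measurable υt)
    (hs : IsMaxOn M.EL Set.univ υs) (hG : IsMaxOn M.ELG Set.univ υG)
    (ht : ∀ ω ∈ M.goodSet D υG x, IsMaxOn (M.LG ω) Set.univ (υt ω))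
    -- localization
    (hs_loc : υs ∈ M.localSet D δ₀ (ErrInOp.oper υs))
    (hG_loc : υG ∈ M.localSet D δ₀ (ErrInOp.oper υs))
    (ht_loc : ∀ ω ∈ M.goodSet D υG x, υt ω ∈ M.localSet D δ₀ (ErrInOp.oper υs))
    -- `A*ᵀ A* ≤ D² ≤ A*ᵀ A* + G²`
    (hD_low : (D * D -
      (ErrInOp.toMat (ErrInOp.oper υs)).transpose * ErrInOp.toMat (ErrInOp.oper υs)).PosSemidef)
    (hD_up : ((ErrInOp.toMat (ErrInOp.oper υs)).transpose * ErrInOp.toMat (ErrInOp.oper υs)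
      + M.G.transpose * M.G - D * D).PosSemidef)
    -- the deviation condition on the score
    (hdev : ErrInOp.DeviationCondition M.P (M.metric D * (M.infoG υG)⁻¹) M.score x)
    (κ : ℝ) (hκ : κ = 2)
    (hR : 3 / 2 * max (M.rD D υG x) (M.bD D υG υs) ≤ M.radius D δ₀)
    (hτ : κ ^ 2 * M.tau3 D * max (M.rD D υG x) (M.bD D υG υs) < 4 / 9) :
    -- the matrices to be inverted are positive definite
    (M.infoG υG).PosDef ∧ (M.semiInfo υG).PosDef ∧
    -- the random set and the bounds for the stochastic term
    MeasureTheory.NullMeasurableSet (M.goodSet D υG x) M.P ∧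
    1 - 3 * Real.exp (-x) ≤ M.P.real (M.goodSet D υG x) ∧
    M.rD D υG x ≤ √(M.BD D υG).trace + √(2 * x * ErrInOp.opNorm (M.BD D υG)) ∧
    (∀ ω, ‖M.stdStoch D υG ω‖ ^ 2 ≤ κ ^ 4 * ‖M.noiseZ ω‖ ^ 2
      + κ ^ 4 * ‖ErrInOp.act (ErrInOp.matSqrt (1 + (κ ^ 2 / M.μ ^ 2) • (M.K.transpose * M.K)))⁻¹
          (M.noiseU ω)‖ ^ 2) ∧
    -- Wilks expansion
    (∀ ω ∈ M.goodSet D υG x,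
      |2 * M.profile ω (ErrInOp.target (υt ω)) - 2 * M.profile ω (ErrInOp.target υG)
          - ‖M.semiScore υG ω‖ ^ 2|
        ≤ M.tau3 D / 2 * (‖M.stdStoch D υG ω‖ ^ 3 + ‖M.stdStochNuis υG ω‖ ^ 3)) ∧
    M.effDim D υG = ∫ ω, ‖M.stdStoch D υG ω‖ ^ 2 ∂M.P ∧
    ∀ (m : ℕ) (Q : Matrix (Fin m) (Fin p) ℝ),
      -- Fisher expansion
      (∀ ω ∈ M.goodSet D υG x,
        ‖ErrInOp.act Q (ErrInOp.target (υt ω) - ErrInOp.target υG - ErrInOp.target (M.stoch υG ω))‖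
          ≤ ErrInOp.opNorm (Q * D⁻¹) * (3 * κ ^ 2 * M.tau3 D / 4) * ‖M.stdStoch D υG ω‖ ^ 2) ∧
      -- estimation bias
      ‖ErrInOp.act Q (ErrInOp.target υG - ErrInOp.target υs + ErrInOp.target (M.bias υG υs))‖
        ≤ ErrInOp.opNorm (Q * D⁻¹) * (3 * κ ^ 2 * M.tau3 D / 4) * M.bD D υG υs ^ 2 ∧
      -- PAC loss bound
      (∀ ω ∈ M.goodSet D υG x,
        ‖ErrInOp.act Q (ErrInOp.target (υt ω) - ErrInOp.target υs - ErrInOp.target (M.stoch υG ω)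
            + ErrInOp.target (M.bias υG υs))‖
          ≤ ErrInOp.opNorm (Q * D⁻¹) * (3 * κ ^ 2 * M.tau3 D / 4)
            * (‖M.stdStoch D υG ω‖ ^ 2 + M.bD D υG υs ^ 2)) ∧
      -- `L₂`-norm risk bound
      MeasureTheory.IntegrableOn
        (fun ω => ‖ErrInOp.act Q (ErrInOp.target (υt ω) - ErrInOp.target υs)‖ ^ 2)
        (M.goodSet D υG x) M.P ∧
      ∫ ω in M.goodSet D υG x, ‖ErrInOp.act Q (ErrInOp.target (υt ω) - ErrInOp.target υs)‖ ∂M.P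
        ≤ √(M.riskQ D υG υs x Q)
          + ErrInOp.opNorm (Q * D⁻¹) * (3 * κ ^ 2 * M.tau3 D / 4)
            * (M.effDim D υG + M.bD D υG υs ^ 2) ∧
      M.riskQ D υG υs x Q
        ≤ (ErrInOp.covMat M.P fun ω => ErrInOp.act Q (ErrInOp.target (M.stoch υG ω))).trace
          + ‖ErrInOp.act Q (ErrInOp.target (M.bias υG υs))‖ ^ 2 ∧
      -- squared risk bound
      ∀ C₄ α : ℝ, 0 ≤ C₄ →
        ∫ ω in M.goodSet D υG x, ‖M.stdStoch D υG ω‖ ^ 4 ∂M.P ≤ C₄ ^ 2 * M.effDim D υG ^ 2 →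
        0 < M.riskQ D υG υs x Q →
        α = ErrInOp.opNorm (Q * D⁻¹) * (3 / 4 * κ ^ 2 * M.tau3 D)
          * (C₄ * M.effDim D υG + M.bD D υG υs ^ 2) / √(M.riskQ D υG υs x Q) →
        α < 1 →
        (1 - α) ^ 2 * M.riskQ D υG υs x Q
            ≤ ∫ ω in M.goodSet D υG x, ‖ErrInOp.act Q (ErrInOp.target (υt ω) - ErrInOp.target υs)‖ ^ 2 ∂M.P ∧
          ∫ ω in M.goodSet D υG x, ‖ErrInOp.act Q (ErrInOp.target (υt ω) - ErrInOp.target υs)‖ ^ 2 ∂M.P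
            ≤ (1 + α) ^ 2 * M.riskQ D υG υs x Q := by
  subst hκ
  have h : M.IsAdapted D (oper υs) := ⟨hp, hμ, hD, hD_low, hD_up⟩
  have hS := h.scale_pos
  have hs' := near_of_mem_localSet h hδ hs_loc
  have hG' := near_of_mem_localSet h hδ hG_loc
  have ht' : ∀ ω ∈ M.goodSet D υG x, M.Near D (oper υs) (1 / 10) (υt ω) := fun ω hω =>
    near_of_mem_localSet h hδ (ht_loc ω hω)
  have hF := hG'.posDef_infoG hZ hA h
  have h0 := gradG_eq_zero_of_isMaxOn_ELG hZ hA hG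
  have hsmall : 81 * max (M.rD D υG x) (M.bD D υG υs) < 2 * M.scale D := by
    rw [tau3_eq] at hτ
    have h1 : (2 : ℝ) ^ 2 * (9 / 2 / M.scale D) * max (M.rD D υG x) (M.bD D υG υs)
        = 18 * max (M.rD D υG x) (M.bD D υG υs) / M.scale D := by ring
    rw [h1, div_lt_iff₀ hS] at hτ
    linarith
  have hn : ∀ ω ∈ M.goodSet D υG x, 81 * ‖M.stdStoch D υG ω‖ < 2 * M.scale D := fun ω hω => by
    have h1 : ‖M.stdStoch D υG ω‖ ≤ M.rD D υG x := hω
    have h2 := h1.trans (le_max_left _ (M.bD D υG υs))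
    linarith
  have hb : 81 * M.bD D υG υs < 2 * M.scale D := by
    have h2 := le_max_right (M.rD D υG x) (M.bD D υG υs)
    linarith
  have hτ0 : 0 ≤ M.tau3 D := by
    rw [tau3_eq]
    positivity
  have hmemstd := memLp_stdStoch hZ hA D υG
  have heff : M.effDim D υG = ∫ ω, ‖M.stdStoch D υG ω‖ ^ 2 ∂M.P :=
    trace_covMat hmemstd (integral_stdStoch hZ hA D υG)
  have hgood := nullMeasurableSet_goodSet hZ hA D υG x
  refine ⟨hF, posDef_schur hF, hgood, one_sub_le_goodSet hZ hA D υG x hdev,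
    zFun_le (posSemidef_covMat hmemstd (integral_stdStoch hZ hA D υG)) hx.le,
    norm_stdStoch_sq_le hZ hA h hG', fun ω hω => ?_, heff, fun m Q => ?_⟩
  · refine (abs_profile_sub_le hZ hA h hG' (ht' ω hω) h0 (ht ω hω) (hn ω hω)).trans ?_
    rw [mul_add]
    exact le_add_of_nonneg_right (by positivity)
  rw [show 3 * (2 : ℝ) ^ 2 * M.tau3 D / 4 = 3 * M.tau3 D by ring,
    show 3 / 4 * (2 : ℝ) ^ 2 * M.tau3 D = 3 * M.tau3 D by ring]
  set c := opNorm (Q * D⁻¹) * (3 * M.tau3 D)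
  have hc : 0 ≤ c := mul_nonneg (opNorm_nonneg _) (by positivity)
  have hfisher : ∀ ω ∈ M.goodSet D υG x,
      ‖act Q (target (υt ω) - target υG - target (M.stoch υG ω))‖
        ≤ c * ‖M.stdStoch D υG ω‖ ^ 2 := fun ω hω => by
    have h1 := hn ω hω
    rw [stdStoch_eq] at h1 ⊢
    exact norm_act_critical_le hZ hA h hG' (ht' ω hω) h0
      (M.gradG_add_inner_eq_zero_of_max (isMaxOn_LG_iff.1 (ht ω hω))) h1 Q
  have hbias : ‖act Q (target υG - target υs + target (M.bias υG υs))‖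
      ≤ c * M.bD D υG υs ^ 2 := by
    have h1 := hb
    rw [bD, bias_eq] at h1 ⊢
    have h2 := norm_act_critical_le hZ hA h hG' hs' h0
      (gradG_add_penMat_eq_zero_of_isMaxOn_EL hZ hA hs) h1 Q
    refine le_trans (le_of_eq ?_) h2
    rw [← norm_neg, ← act_neg]
    congr 2
    simp only [target_sub]
    abel
  have hpac : ∀ ω ∈ M.goodSet D υG x,
      ‖act Q (target (υt ω) - target υs - target (M.stoch υG ω) + target (M.bias υG υs))‖
        ≤ c * (‖M.stdStoch D υG ω‖ ^ 2 + M.bD D υG υs ^ 2) := fun ω hω => by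
    rw [show target (υt ω) - target υs - target (M.stoch υG ω) + target (M.bias υG υs)
      = (target (υt ω) - target υG - target (M.stoch υG ω))
        + (target υG - target υs + target (M.bias υG υs)) by abel, act_add, mul_add]
    exact (norm_add_le _ _).trans (add_le_add (hfisher ω hω) hbias)
  -- the loss and its linear approximation as square integrable vectors on `Ω(x)`
  have hPx : (M.P.restrict (M.goodSet D υG x)).real Set.univ ≤ 1 := by
    rw [measureReal_restrict_apply_univ]
    exact measureReal_le_one
  have hmem := ae_restrict_mem₀ hgood
  have hY : MemLp (fun ω => act Q (target (M.stoch υG ω)) - act Q (target (M.bias υG υs))) 2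
      (M.P.restrict (M.goodSet D υG x)) :=
    ((memLp_act_target_stoch hZ hA υG Q).1.sub (memLp_const _)).restrict _
  have hr : MemLp (fun ω => ‖M.stdStoch D υG ω‖ ^ 2) 2 (M.P.restrict (M.goodSet D υG x)) := by
    refine MemLp.of_bound (hmemstd.1.norm.pow 2).restrict (M.rD D υG x ^ 2) ?_
    filter_upwards [hmem] with ω hω
    rw [norm_pow, norm_norm]
    exact pow_le_pow_left₀ (norm_nonneg _) hω 2
  have hX : MemLp (fun ω => act Q (target (υt ω) - target υs)) 2
      (M.P.restrict (M.goodSet D υG x)) := by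
    have h1 : Measurable fun ω => act Q (target (υt ω) - target υs) :=
      (continuous_act Q).measurable.comp
        (((contDiff_target (k := 0)).continuous.measurable.comp hυt).sub_const _)
    refine MemLp.of_bound h1.aestronglyMeasurable
      (opNorm (Q * D⁻¹) * (1 / 10 * M.scale D + 1 / 10 * M.scale D)) ?_
    filter_upwards [hmem] with ω hω
    have h2 : act Q (target (υt ω) - target υs)
        = act (Q * D⁻¹) (act D (target (υt ω)) - act D (target υs)) := by
      rw [← act_sub, mul_act, inv_act_act hD.isUnit]
    rw [h2]
    exact (norm_act_le _ _).trans (mul_le_mul_of_nonneg_left ((norm_sub_le _ _).trans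
      (add_le_add (ht' ω hω).target_le hs'.target_le)) (opNorm_nonneg _))
  have hXY : ∀ᵐ ω ∂M.P.restrict (M.goodSet D υG x),
      ‖act Q (target (υt ω) - target υs)
        - (act Q (target (M.stoch υG ω)) - act Q (target (M.bias υG υs)))‖
      ≤ c * (‖M.stdStoch D υG ω‖ ^ 2 + M.bD D υG υs ^ 2) := by
    filter_upwards [hmem] with ω hω
    have h1 := hpac ω hω
    rw [show target (υt ω) - target υs - target (M.stoch υG ω) + target (M.bias υG υs)
      = target (υt ω) - target υs - (target (M.stoch υG ω) - target (M.bias υG υs)) by abel,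
      act_sub Q (target (υt ω) - target υs), act_sub Q (target (M.stoch υG ω))] at h1
    exact h1
  have hb0 : 0 ≤ M.bD D υG υs ^ 2 := sq_nonneg _
  have heff0 : 0 ≤ M.effDim D υG := heff ▸ integral_nonneg fun _ => sq_nonneg _
  refine ⟨hfisher, hbias, hpac, hX.norm.integrable_sq, ?_, riskQ_le hZ hA D υG υs x Q, ?_⟩
  · refine integral_norm_le_of_close hPx hX hY hr hc hb0 hXY ?_
    rw [heff]
    exact setIntegral_le_integral hmemstd.norm.integrable_sq
      (Filter.Eventually.of_forall fun _ => sq_nonneg _)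
  · intro C₄ α hC hC4 hR0 hα hα1
    have h1 := abs_sqrt_sub_sqrt_le_of_close hPx hX hY hr hc hb0 hXY (mul_nonneg hC heff0)
      (by simpa only [← pow_mul, mul_pow] using hC4)
    set R := M.riskQ D υG υs x Q
    set W := ∫ ω in M.goodSet D υG x, ‖act Q (target (υt ω) - target υs)‖ ^ 2 ∂M.P
    have hW0 : 0 ≤ W := integral_nonneg fun _ => sq_nonneg _
    have hsR : 0 < √R := Real.sqrt_pos.2 hR0
    have h2 : c * (C₄ * M.effDim D υG + M.bD D υG υs ^ 2) = α * √R := by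
      rw [hα, div_mul_cancel₀ _ hsR.ne']
    have h3 : |√W - √R| ≤ α * √R := h2 ▸ h1
    obtain ⟨h4, h5⟩ := abs_le.1 h3
    have hWs := Real.sq_sqrt hW0
    have hRs := Real.sq_sqrt hR0.le
    constructor
    · rw [← hRs, ← mul_pow, ← hWs]
      exact pow_le_pow_left₀ (mul_nonneg (by linarith) hsR.le) (by linarith) 2
    · rw [← hRs, ← mul_pow, ← hWs]
      exact pow_le_pow_left₀ (Real.sqrt_nonneg _) (by linarith) 2
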